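/- Let $\nu>0$, $\alpha\in\mathbb R$, $L>0$ and $s\ge \tfrac12$. There is a function $T'\mapsto c_{T'}=c_{s,L,\alpha,\nu,T'}\in(0,\infty)$ of $T'>0$, which remains bounded as $T'\to0^+$, such that the following holds for every $T'>0$ and all $g\in H^{\frac{2s+1}{4}}(\mathbb R)$, $h\in H^{\frac{2s-1}{4}}(\mathbb R)$ that vanish almost everywhere outside $(0,T')$. The reduced initial-boundary value problem $$ v_t-(\nu+i\alpha)v_{xx}=0\ \text{ on }(0,L)\times(0,T'),\qquad v(x,0)=0,\qquad v(0,t)=g(t),\quad v_x(L,t)=h(t), $$ has exactly one solution $v$, where a solution is a map $x\mapsto v(x)$ in $C^1([0,L];L^2(0,T'))$, with derivative $x\mapsto v_x(x)$, such that $v(0)=g$ and $v_x(L)=h$ in $L^2(0,T')$ and such that the equation and the zero initial condition hold in the sense of distributions, i.e. $$ \int_0^L\int_0^{T'} v\,\big(\varphi_t+(\nu+i\alpha)\varphi_{xx}\big)\,dt\,dx=0\qquad\text{for all }\varphi\in C_c^\infty\big((0,L)\times(-\infty,T')\big). $$ This solution satisfies $$ \sup_{x\in[0,L]}\|v(x)\|_{H_t^{\frac{2s+1}{4}}(0,T')}\le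 c_{T'}\Big(\|g\|_{H^{\frac{2s+1}{4}}(\mathbb R)}+\|h\|_{H^{\frac{2s-1}{4}}(\mathbb R)}\Big), $$ $$ \sup_{x\in[0,L]}\|v_x(x)\|_{H_t^{\frac{2s-1}{4}}(0,T')}\le c_{T'}\Big(\|g\|_{H^{\frac{2s+1}{4}}(\mathbb R)}+\|h\|_{H^{\frac{2s-1}{4}}(\mathbb R)}\Big), $$ and the maps $[0,L]\ni x\mapsto v(x)\in H_t^{\frac{2s+1}{4}}(0,T')$ and $[0,L]\ni x\mapsto v_x(x)\in H_t^{\frac{2s-1}{4}}(0,T')$ are continuous. Here all functions are complex-valued, $\|u\|_{H^m(\mathbb R)}^2=\frac1{2\pi}\int_{\mathbb R}(1+\tau^2)^m\,|\widehat u(\tau)|^2\,d\tau$ with $\widehat u(\tau)=\int_{\mathbb R}e^{-i\tau t}u(t)\,dt$, and $H^m(0,T')$ is the space of restrictions to $(0,T')$ of elements of $H^m(\mathbb R)$ with the infimum norm over all extensions. -/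

import Mathlib

open MeasureTheory Set Filter Topology
open scoped ENNReal FourierTransform

noncomputable section

/-- Complex-valued square-integrable functions of time on the real line. -/
abbrev TimeL2 : Type := Lp ℂ 2 (volume : Measure ℝ)

/-- Complex-valued square-integrable functions of time on the interval `(0, T)`. -/
abbrev TimeL2On (T : ℝ) : Type := Lp ℂ 2 (volume.restrict (Ioo (0 : ℝ) T))

/-- The `H^m(ℝ)` norm (`m ≥ 0`) of a square-integrable function, with value `∞` exactly when the
function is not in `H^m(ℝ)`. Mathlib's (unitary) Fourier transform has the phase
`exp (-2 π i ξ t)`, so the usual frequency is `τ = 2 π ξ` and the weight is `(1 + τ ^ 2) ^ m`. -/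
def sobolevNorm (m : ℝ) (u : TimeL2) : ℝ≥0∞ :=
  (∫⁻ ξ : ℝ, ENNReal.ofReal ((1 + (2 * Real.pi * ξ) ^ 2) ^ m) *
    ‖(𝓕 u : TimeL2) ξ‖ₑ ^ 2) ^ (1 / 2 : ℝ)

/-- The `H^m(0, T)` norm (`m ≥ 0`): `H^m(0, T)` is the space of restrictions to `(0, T)` of
elements of `H^m(ℝ)`, with the infimum of the norms of all extensions. The value is `∞` exactly
when the function is not in `H^m(0, T)`. -/
def sobolevNormOn (m T : ℝ) (u : TimeL2On T) : ℝ≥0∞ :=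
  ⨅ (U : TimeL2) (_ : ∀ᵐ t ∂(volume.restrict (Ioo (0 : ℝ) T)), U t = u t), sobolevNorm m U

/-- `x ↦ v x ∈ L²(0, T)`, with `x`-derivative `x ↦ vx x ∈ L²(0, T)`, solves
  `v_t - (ν + i α) v_xx = 0` on `(0, L) × (0, T)`,
  `v(x, 0) = 0`, `v(0, t) = g(t)`, `v_x(L, t) = h(t)`.
The solution lies in `C¹([0, L]; L²(0, T))`, so that the boundary values are attained in
`L²(0, T)`; the equation and the zero initial condition hold in the sense of distributions
(the test functions need not vanish at time `0`). -/
structure IsReducedSolution (ν α L T : ℝ) (g h : TimeL2) (v vx : ℝ → TimeL2On T) : Prop where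
  hasDeriv : ∀ x ∈ Icc 0 L, HasDerivWithinAt v (vx x) (Icc 0 L) x
  continuousOn_deriv : ContinuousOn vx (Icc 0 L)
  dirichlet : ∀ᵐ t ∂(volume.restrict (Ioo (0 : ℝ) T)), v 0 t = g t
  neumann : ∀ᵐ t ∂(volume.restrict (Ioo (0 : ℝ) T)), vx L t = h t
  equation : ∀ φ : ℝ × ℝ → ℂ, ContDiff ℝ (⊤ : ℕ∞) φ → HasCompactSupport φ →
    tsupport φ ⊆ Ioo 0 L ×ˢ Iio T →
    ∫ x in Ioo 0 L, ∫ t in Ioo 0 T,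
      v x t * (deriv (fun t' => φ (x, t')) t +
        ((ν : ℂ) + Complex.I * α) * iteratedDeriv 2 (fun x' => φ (x', t)) x) = 0

/-- The map `x ↦ w x` is continuous from `[0, L]` into `H^m(0, T)`. -/
def ContinuousIntoSobolev (m L T : ℝ) (w : ℝ → TimeL2On T) : Prop :=
  ∀ x ∈ Icc 0 L, sobolevNormOn m T (w x) < ∞ ∧
    Tendsto (fun y => sobolevNormOn m T (w y - w x)) (𝓝[Icc 0 L] x) (𝓝 0)

end

/-! Write κ = ν + iα. The Fourier transform in time turns the equation into the two-point problem κ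
v_xx = iτ v on [0, L]. Its solution is v = cosh(λ(L - x))/cosh(λL) ĝ + sinh(λx)/(λ cosh(λL)) ĥ,
where κλ² = iτ and Re λ ≥ 0. Since Re κ > 0, λ stays in a sector |Im λ| ≤ M Re λ, where |cosh(λL)|
is comparable to cosh(L Re λ). Hence the multipliers from g and h to v have orders 0 and -1/2 in τ,
and those to v_x have orders 1/2 and 0, uniformly in x and without loss at low frequency
(`exists_symbol_bound`). Plancherel gives both estimates on the whole time line, and dominated
convergence gives continuity in x (`exists_wholeLine_solution`). The data are already functions on
ℝ, so the constant does not depend on T'.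

It remains to see that this solution vanishes for t < 0 and that every solution on (0, T') is its
restriction. Both follow from one energy argument. The equation is put in the form (R v_x)_x = κ⁻¹(v
- Rv) with R = (1 + ∂ₜ)⁻¹, which involves only bounded operators because ∂ₜR = 1 - R. Let P be the
projection onto times before a. The resolvent is causal, PR = PRP (`past_timeResolvent`), and its
Cayley transform 1 - 2R is a contraction (`norm_cayley_le`). Together these give Re⟨PRu, P(u - Ru)⟩
≥ 0. If Pv vanishes at x = 0 and Pv_x at x = L, then Re(κ⟨PRv, PRv_x⟩) is nondecreasing in x and
zero at both ends, hence zero, and this forces Pv = 0 (`past_eq_zero_of_resolvent_equation`). The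
case a = 0 is causality of the whole-line solution. The case a = T', for the extension by zero of a
difference of two solutions, is uniqueness.

The weak form implies the resolvent form by testing with η(x)f(t), where f solves the backward
equation f - f' = ψ, followed by the lemma of du Bois-Reymond. The converse is an integration by
parts in x. -/

noncomputable section

/-! ### Convergence and differentiation in L² -/

section

/-- The element of `L²(ℝ)` represented by `f`, and `0` if `f` is not square-integrable. -/
def toL2 (f : ℝ → ℂ) : TimeL2 :=
  open scoped Classical in if hf : MemLp f 2 (volume : Measure ℝ) then hf.toLp f else 0

lemma coeFn_toL2 {f : ℝ → ℂ} (hf : MemLp f 2 (volume : Measure ℝ)) : toL2 f =ᵐ[volume] f := by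
  rw [toL2, dif_pos hf]
  exact hf.coeFn_toLp

lemma toL2_coeFn (u : TimeL2) : toL2 u = u := by
  rw [toL2, dif_pos (Lp.memLp u)]
  exact Lp.toLp_coeFn u _

lemma toL2_congr {f g : ℝ → ℂ} (hf : MemLp f 2 (volume : Measure ℝ)) (h : f =ᵐ[volume] g) :
    toL2 f = toL2 g := by
  have hg : MemLp g 2 (volume : Measure ℝ) := hf.ae_eq h
  exact Lp.ext ((coeFn_toL2 hf).trans (h.trans (coeFn_toL2 hg).symm))

lemma enorm_timeL2 (u : TimeL2) : ‖u‖ₑ = (∫⁻ ξ, ‖u ξ‖ₑ ^ 2) ^ (1 / 2 : ℝ) := by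
  rw [Lp.enorm_def, eLpNorm_eq_lintegral_rpow_enorm_toReal (by norm_num) (by norm_num)]
  simp

/-- Dominated convergence with a weight: w = 1 serves L² and w = (1 + τ²)^m serves H^m. -/
lemma tendsto_lintegral_mul_enorm_sq {ι : Type*} {l : Filter ι} [l.IsCountablyGenerated]
    {w : ℝ → ℝ≥0∞} (hw : Measurable w) (hwf : ∀ ξ, w ξ ≠ ∞) {F : ι → ℝ → ℂ} {b : ℝ → ℝ}
    (hF : ∀ᶠ i in l, AEStronglyMeasurable (F i) volume)
    (hb : ∀ᶠ i in l, ∀ᵐ ξ, ‖F i ξ‖ ≤ b ξ)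
    (hfin : ∫⁻ ξ, w ξ * ENNReal.ofReal (b ξ) ^ 2 ≠ ∞)
    (hlim : ∀ᵐ ξ, Tendsto (fun i => F i ξ) l (𝓝 0)) :
    Tendsto (fun i => ∫⁻ ξ, w ξ * ‖F i ξ‖ₑ ^ 2) l (𝓝 0) := by
  have h0 : (0 : ℝ≥0∞) = ∫⁻ _ : ℝ, 0 := by simp
  rw [h0]
  refine tendsto_lintegral_filter_of_dominated_convergence'
    (fun ξ => w ξ * ENNReal.ofReal (b ξ) ^ 2) ?_ ?_ hfin ?_
  · filter_upwards [hF] with i hi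
    exact hw.aemeasurable.mul (hi.enorm.pow_const 2)
  · filter_upwards [hb] with i hi
    filter_upwards [hi] with ξ hξ
    gcongr
    rw [← ofReal_norm]
    exact ENNReal.ofReal_le_ofReal hξ
  · filter_upwards [hlim] with ξ hξ
    have h1 : Tendsto (fun i => ‖F i ξ‖ₑ ^ 2) l (𝓝 0) := by
      have := ((continuous_enorm.tendsto _).comp hξ)
      simpa using ENNReal.Tendsto.pow (n := 2) this
    simpa using ENNReal.Tendsto.const_mul h1 (Or.inr (hwf ξ))

lemma tendsto_toL2 {ι : Type*} {l : Filter ι} [l.IsCountablyGenerated]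
    {F : ι → ℝ → ℂ} {f : ℝ → ℂ} {b : ℝ → ℝ}
    (hF : ∀ᶠ i in l, MemLp (F i) 2 (volume : Measure ℝ)) (hf : MemLp f 2 (volume : Measure ℝ))
    (hb : MemLp b 2 (volume : Measure ℝ))
    (hbound : ∀ᶠ i in l, ∀ᵐ ξ, ‖F i ξ - f ξ‖ ≤ b ξ)
    (hlim : ∀ᵐ ξ, Tendsto (fun i => F i ξ) l (𝓝 (f ξ))) :
    Tendsto (fun i => toL2 (F i)) l (𝓝 (toL2 f)) := by
  rw [tendsto_iff_edist_tendsto_0]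
  have key := tendsto_lintegral_mul_enorm_sq (w := fun _ => 1) (F := fun i ξ => F i ξ - f ξ)
    (b := b) (l := l) measurable_const (by simp)
    (hF.mono fun i hi => hi.1.sub hf.1) hbound ?_ ?_
  · have h2 := (ENNReal.continuous_rpow_const (y := (1 / 2 : ℝ))).tendsto 0 |>.comp key
    rw [ENNReal.zero_rpow_of_pos (by norm_num)] at h2
    refine h2.congr' ?_
    filter_upwards [hF] with i hi
    rw [edist_eq_enorm_sub, enorm_timeL2]
    simp only [Function.comp, one_mul]
    congr 1
    apply lintegral_congr_ae
    filter_upwards [Lp.coeFn_sub (toL2 (F i)) (toL2 f), coeFn_toL2 hi, coeFn_toL2 hf]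
      with ξ h1 h2 h3
    rw [h1, Pi.sub_apply, h2, h3]
  · have h := hb.eLpNorm_lt_top
    rw [eLpNorm_eq_lintegral_rpow_enorm_toReal (by norm_num) (by norm_num)] at h
    have h' := (ENNReal.rpow_lt_top_iff_of_pos (by norm_num)).1 h
    refine ne_of_lt (lt_of_le_of_lt ?_ h')
    simp only [one_mul]
    refine lintegral_mono fun ξ => ?_
    simp only [ENNReal.toReal_ofNat, ENNReal.rpow_ofNat]
    gcongr
    exact Real.ofReal_le_enorm (b ξ)
  · filter_upwards [hlim] with ξ hξ
    simpa using hξ.sub_const (f ξ)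

lemma toL2_sub {f g : ℝ → ℂ} (hf : MemLp f 2 (volume : Measure ℝ))
    (hg : MemLp g 2 (volume : Measure ℝ)) :
    toL2 (fun t => f t - g t) = toL2 f - toL2 g := by
  apply Lp.ext
  filter_upwards [coeFn_toL2 (hf.sub hg), Lp.coeFn_sub (toL2 f) (toL2 g), coeFn_toL2 hf,
    coeFn_toL2 hg] with ξ h1 h2 h3 h4
  rw [h2, Pi.sub_apply, h3, h4]
  exact h1

lemma toL2_const_mul (c : ℂ) {f : ℝ → ℂ} (hf : MemLp f 2 (volume : Measure ℝ)) :
    toL2 (fun t => c * f t) = c • toL2 f := by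
  apply Lp.ext
  filter_upwards [coeFn_toL2 (hf.const_mul c), Lp.coeFn_smul c (toL2 f), coeFn_toL2 hf]
    with ξ h1 h2 h3
  rw [h2, Pi.smul_apply, h3]
  exact h1

/-- Differentiation under the `L²` norm. -/
lemma hasDerivWithinAt_toL2 {f f' : ℝ → ℝ → ℂ} {b : ℝ → ℝ} {a c : ℝ}
    (hf : ∀ x ∈ Icc a c, MemLp (f x) 2 (volume : Measure ℝ))
    (hf' : ∀ x ∈ Icc a c, MemLp (f' x) 2 (volume : Measure ℝ))
    (hb : MemLp b 2 (volume : Measure ℝ))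
    (hbound : ∀ᵐ ξ, ∀ x ∈ Icc a c, ‖f' x ξ‖ ≤ b ξ)
    (hderiv : ∀ᵐ ξ, ∀ x ∈ Icc a c, HasDerivWithinAt (fun y => f y ξ) (f' x ξ) (Icc a c) x) :
    ∀ x ∈ Icc a c, HasDerivWithinAt (fun y => toL2 (f y)) (toL2 (f' x)) (Icc a c) x := by
  intro x hx
  rw [hasDerivWithinAt_iff_tendsto_slope]
  have hmem : ∀ᶠ y in 𝓝[Icc a c \ {x}] x, y ∈ Icc a c \ {x} := self_mem_nhdsWithin
  have hS : ∀ y ∈ Icc a c, MemLp (fun ξ => ((y - x : ℝ) : ℂ)⁻¹ * (f y ξ - f x ξ)) 2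
      (volume : Measure ℝ) := fun y hy => ((hf y hy).sub (hf x hx)).const_mul _
  -- By the mean value inequality the difference quotient is bounded by `b`, as is the derivative,
  -- so `2 * b` dominates their difference.
  have key := tendsto_toL2 (l := 𝓝[Icc a c \ {x}] x)
    (F := fun y ξ => ((y - x : ℝ) : ℂ)⁻¹ * (f y ξ - f x ξ)) (f := f' x) (b := fun ξ => 2 * b ξ)
    (hmem.mono fun y hy => hS y hy.1) (hf' x hx) (hb.const_mul 2) ?_ ?_
  · refine key.congr' ?_
    filter_upwards [hmem] with y hy
    rw [toL2_const_mul _ (f := fun ξ => f y ξ - f x ξ) ((hf y hy.1).sub (hf x hx)), toL2_sub (hf y hy.1) (hf x hx),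
      slope_def_module]
    norm_cast
  · filter_upwards [hmem] with y hy
    filter_upwards [hbound, hderiv] with ξ h1 h2
    have hyx : y - x ≠ 0 := sub_ne_zero.2 hy.2
    have h3 : ‖f y ξ - f x ξ‖ ≤ b ξ * ‖y - x‖ :=
      (convex_Icc a c).norm_image_sub_le_of_norm_hasDerivWithin_le h2 h1 hx hy.1
    have h4 : ‖((y - x : ℝ) : ℂ)⁻¹ * (f y ξ - f x ξ)‖ ≤ b ξ := by
      rw [norm_mul, norm_inv, Complex.norm_real, inv_mul_le_iff₀ (norm_pos_iff.2 hyx), mul_comm]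
      exact h3
    linarith [norm_sub_le (((y - x : ℝ) : ℂ)⁻¹ * (f y ξ - f x ξ)) (f' x ξ), h1 x hx]
  · filter_upwards [hderiv] with ξ h
    have := hasDerivWithinAt_iff_tendsto_slope.1 (h x hx)
    refine this.congr fun y => ?_
    rw [slope_def_module, Complex.real_smul]
    norm_cast

/-! ### Multiplication operators, projection onto the past, restriction and extension -/

/-- Multiplication by a measurable function bounded by one, as an operator on `L²(ℝ)`. -/
def mulOp (m : ℝ → ℂ) (hm : Measurable m) (hb : ∀ t, ‖m t‖ ≤ 1) : TimeL2 →L[ℂ] TimeL2 :=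
  have hL : ∀ u : TimeL2, MemLp (fun t => m t * u t) 2 (volume : Measure ℝ) := fun u =>
    MemLp.of_le (Lp.memLp u) (hm.aestronglyMeasurable.mul (Lp.memLp u).1)
      (Eventually.of_forall fun t => by
        rw [norm_mul]
        exact mul_le_of_le_one_left (norm_nonneg _) (hb t))
  LinearMap.mkContinuous
    { toFun := fun u => toL2 fun t => m t * u t
      map_add' := fun u v => by
        apply Lp.ext
        filter_upwards [coeFn_toL2 (hL (u + v)), coeFn_toL2 (hL u), coeFn_toL2 (hL v),
          Lp.coeFn_add u v, Lp.coeFn_add (toL2 fun t => m t * u t) (toL2 fun t => m t * v t)]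
          with t h1 h2 h3 h4 h5
        rw [h1, h5, Pi.add_apply, h2, h3, h4, Pi.add_apply, mul_add]
      map_smul' := fun c u => by
        apply Lp.ext
        filter_upwards [coeFn_toL2 (hL (c • u)), coeFn_toL2 (hL u), Lp.coeFn_smul c u,
          Lp.coeFn_smul c (toL2 fun t => m t * u t)] with t h1 h2 h3 h4
        rw [h1, RingHom.id_apply, h4, Pi.smul_apply, h2, h3, Pi.smul_apply]
        simp only [smul_eq_mul]
        ring }
    1 fun u => by
      rw [one_mul]
      refine Lp.norm_le_norm_of_ae_le ?_
      filter_upwards [coeFn_toL2 (hL u)] with t h1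
      simp only [LinearMap.coe_mk, AddHom.coe_mk]
      rw [h1, norm_mul]
      exact mul_le_of_le_one_left (norm_nonneg _) (hb t)

lemma coeFn_mulOp (m : ℝ → ℂ) (hm : Measurable m) (hb : ∀ t, ‖m t‖ ≤ 1) (u : TimeL2) :
    mulOp m hm hb u =ᵐ[volume] fun t => m t * u t :=
  coeFn_toL2 (MemLp.of_le (Lp.memLp u) (hm.aestronglyMeasurable.mul (Lp.memLp u).1)
      (Eventually.of_forall fun t => by
        rw [norm_mul]
        exact mul_le_of_le_one_left (norm_nonneg _) (hb t)))

lemma norm_mulOp_le (m : ℝ → ℂ) (hm : Measurable m) (hb : ∀ t, ‖m t‖ ≤ 1) (u : TimeL2) :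
    ‖mulOp m hm hb u‖ ≤ ‖u‖ := by
  refine Lp.norm_le_norm_of_ae_le ?_
  filter_upwards [coeFn_mulOp m hm hb u] with t h1
  rw [h1, norm_mul]
  exact mul_le_of_le_one_left (norm_nonneg _) (hb t)

/-- The projection of `L²(ℝ)` onto the functions that vanish after time `a`. -/
def past (a : ℝ) : TimeL2 →L[ℂ] TimeL2 :=
  mulOp ((Iio a).indicator 1) (measurable_one.indicator measurableSet_Iio) fun t => by
    by_cases h : t ∈ Iio a <;> simp [h]

lemma coeFn_past (a : ℝ) (u : TimeL2) : past a u =ᵐ[volume] (Iio a).indicator u := by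
  filter_upwards [coeFn_mulOp ((Iio a).indicator 1) (measurable_one.indicator measurableSet_Iio)
    (fun t => by by_cases h : t ∈ Iio a <;> simp [h]) u] with t h
  rw [past, h]
  by_cases ht : t ∈ Iio a <;> simp [ht]

lemma norm_past_le (a : ℝ) (u : TimeL2) : ‖past a u‖ ≤ ‖u‖ := norm_mulOp_le _ _ _ _

lemma past_past (a : ℝ) (u : TimeL2) : past a (past a u) = past a u := by
  apply Lp.ext
  filter_upwards [coeFn_past a u, coeFn_past a (past a u)] with t h1 h2
  rw [h2, h1]
  by_cases ht : t ∈ Iio a <;> simp [ht, h1]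

lemma past_eq_zero_iff (a : ℝ) (u : TimeL2) : past a u = 0 ↔ ∀ᵐ t, t < a → u t = 0 := by
  constructor
  · intro h
    have h0 : past a u =ᵐ[volume] (0 : ℝ → ℂ) := by rw [h]; exact Lp.coeFn_zero _ _ _
    filter_upwards [coeFn_past a u, h0] with t h1 h2 ht
    rw [h2, indicator_of_mem (show t ∈ Iio a from ht)] at h1
    simpa using h1.symm
  · intro h
    apply Lp.ext
    filter_upwards [coeFn_past a u, h, Lp.coeFn_zero ℂ 2 (volume : Measure ℝ)] with t h1 h2 h3
    rw [h1, h3]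
    by_cases ht : t < a
    · simp [h2 ht]
    · simp [ht]

/-- Restriction of functions of time to `(0, T)`. -/
def restrictTime (T : ℝ) : TimeL2 →L[ℂ] TimeL2On T :=
  LpToLpRestrictCLM ℝ ℂ ℂ volume 2 (Ioo 0 T)

lemma coeFn_restrictTime (T : ℝ) (u : TimeL2) :
    restrictTime T u =ᵐ[volume.restrict (Ioo 0 T)] u :=
  LpToLpRestrictCLM_coeFn ℂ (Ioo 0 T) u

lemma memLp_extend (T : ℝ) (u : TimeL2On T) :
    MemLp ((Ioo 0 T).indicator u) 2 (volume : Measure ℝ) :=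
  (memLp_indicator_iff_restrict measurableSet_Ioo).2 (Lp.memLp u)

/-- Extension by zero of functions of time on `(0, T)`. -/
def extendTime (T : ℝ) : TimeL2On T →L[ℂ] TimeL2 :=
  LinearMap.mkContinuous
    { toFun := fun u => toL2 ((Ioo 0 T).indicator u)
      map_add' := fun u v => by
        apply Lp.ext
        filter_upwards [coeFn_toL2 (memLp_extend T (u + v)), coeFn_toL2 (memLp_extend T u),
          coeFn_toL2 (memLp_extend T v), (ae_restrict_iff' measurableSet_Ioo).1 (Lp.coeFn_add u v),
          Lp.coeFn_add (toL2 ((Ioo 0 T).indicator u)) (toL2 ((Ioo 0 T).indicator v))]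
          with t h1 h2 h3 h4 h5
        rw [h1, h5, Pi.add_apply, h2, h3]
        by_cases ht : t ∈ Ioo 0 T
        · simp only [indicator_of_mem ht]
          exact h4 ht
        · simp [ht]
      map_smul' := fun c u => by
        apply Lp.ext
        filter_upwards [coeFn_toL2 (memLp_extend T (c • u)), coeFn_toL2 (memLp_extend T u),
          (ae_restrict_iff' measurableSet_Ioo).1 (Lp.coeFn_smul c u),
          Lp.coeFn_smul c (toL2 ((Ioo 0 T).indicator u))] with t h1 h2 h4 h5
        rw [h1, RingHom.id_apply, h5, Pi.smul_apply, h2]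
        by_cases ht : t ∈ Ioo 0 T
        · simp only [indicator_of_mem ht]
          exact h4 ht
        · simp [ht] }
    1 fun u => by
      rw [one_mul]
      simp only [LinearMap.coe_mk, AddHom.coe_mk]
      rw [toL2, dif_pos (memLp_extend T u), Lp.norm_toLp,
        eLpNorm_indicator_eq_eLpNorm_restrict measurableSet_Ioo, Lp.norm_def]

lemma coeFn_extendTime (T : ℝ) (u : TimeL2On T) :
    extendTime T u =ᵐ[volume] (Ioo 0 T).indicator u := coeFn_toL2 (memLp_extend T u)

lemma extendTime_injective (T : ℝ) : Function.Injective (extendTime T) := by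
  rw [injective_iff_map_eq_zero]
  intro u hu
  apply Lp.ext
  have h0 : extendTime T u =ᵐ[volume] (0 : ℝ → ℂ) := by rw [hu]; exact Lp.coeFn_zero _ _ _
  have h1 : ∀ᵐ t ∂volume.restrict (Ioo 0 T), u t = 0 := by
    rw [ae_restrict_iff' measurableSet_Ioo]
    filter_upwards [h0, coeFn_extendTime T u] with t h1 h2 ht
    rw [h1, indicator_of_mem ht] at h2
    simpa using h2.symm
  filter_upwards [h1, Lp.coeFn_zero ℂ 2 (volume.restrict (Ioo 0 T))] with t h1 h2
  rw [h1, h2]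
  rfl

end

/-! ### The causal resolvent of the time derivative -/

section

open scoped SchwartzMap ContDiff ComplexConjugate

lemma inner_toL2 {f : ℝ → ℂ} (hf : MemLp f 2 (volume : Measure ℝ)) (u : TimeL2) :
    inner ℂ (toL2 f) u = ∫ t, conj (f t) * u t := by
  rw [L2.inner_def]
  refine integral_congr_ae ?_
  filter_upwards [coeFn_toL2 hf] with t ht
  rw [ht, RCLike.inner_apply, mul_comm]

lemma toL2_schwartz (f : 𝓢(ℝ, ℂ)) : toL2 f = f.toLp 2 := by
  rw [toL2, dif_pos (f.memLp 2 volume)]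
  rfl

lemma memLp_schwartz (f : 𝓢(ℝ, ℂ)) : MemLp f 2 (volume : Measure ℝ) := f.memLp 2 volume

lemma fourier_toL2_schwartz (f : 𝓢(ℝ, ℂ)) : 𝓕 (toL2 f) = toL2 (𝓕 f : 𝓢(ℝ, ℂ)) := by
  rw [toL2_schwartz, toL2_schwartz, SchwartzMap.toLp_fourier_eq]

lemma schwartz_lineDeriv_eq (f : 𝓢(ℝ, ℂ)) :
    LineDeriv.lineDerivOp (1 : ℝ) f = SchwartzMap.derivCLM ℂ ℂ f := by
  ext x
  rw [SchwartzMap.lineDerivOp_apply_eq_fderiv, SchwartzMap.derivCLM_apply, fderiv_apply_one_eq_deriv]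

lemma fourier_schwartz_deriv (f : 𝓢(ℝ, ℂ)) (ξ : ℝ) :
    (𝓕 (SchwartzMap.derivCLM ℂ ℂ f) : 𝓢(ℝ, ℂ)) ξ =
      2 * Real.pi * Complex.I * ξ * (𝓕 f : 𝓢(ℝ, ℂ)) ξ := by
  rw [← schwartz_lineDeriv_eq, SchwartzMap.fourier_lineDerivOp_eq, smul_apply,
    SchwartzMap.smulLeftCLM_apply_apply (by fun_prop)]
  simp
  ring

lemma schwartz_fourier_sub (f g : 𝓢(ℝ, ℂ)) (ξ : ℝ) :
    (𝓕 (f - g) : 𝓢(ℝ, ℂ)) ξ = (𝓕 f : 𝓢(ℝ, ℂ)) ξ - (𝓕 g : 𝓢(ℝ, ℂ)) ξ := by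
  have := map_sub (FourierTransform.fourierEquiv ℂ 𝓢(ℝ, ℂ)) f g
  simp only [FourierTransform.fourierEquiv_apply] at this
  rw [this]
  rfl

lemma conj_two : conj (2 : ℂ) = 2 := Complex.conj_eq_iff_im.2 (by simp)

/-- The symbol of the resolvent `(1 + ∂ₜ)⁻¹`. -/
def resolventSymbol (ξ : ℝ) : ℂ := (1 + 2 * Real.pi * Complex.I * ξ)⁻¹

lemma normSq_resolvent_denom (ξ : ℝ) :
    Complex.normSq (1 + 2 * Real.pi * Complex.I * ξ) = 1 + (2 * Real.pi * ξ) ^ 2 := by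
  simp [Complex.normSq_apply]
  ring

lemma resolvent_denom_ne_zero (ξ : ℝ) : (1 + 2 * Real.pi * Complex.I * ξ : ℂ) ≠ 0 := by
  rw [← Complex.normSq_pos, normSq_resolvent_denom]
  positivity

lemma measurable_resolventSymbol : Measurable resolventSymbol := by
  unfold resolventSymbol
  fun_prop

lemma norm_resolventSymbol_le (ξ : ℝ) : ‖resolventSymbol ξ‖ ≤ 1 := by
  rw [resolventSymbol, norm_inv]
  apply inv_le_one_of_one_le₀
  rw [Complex.norm_def, normSq_resolvent_denom, Real.one_le_sqrt]
  nlinarith [sq_nonneg (2 * Real.pi * ξ)]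

/-- The symbol of 1 - 2R is (iτ - 1)/(iτ + 1), whose numerator is minus the conjugate of its
denominator. -/
lemma norm_cayley_symbol (ξ : ℝ) : ‖1 - 2 * resolventSymbol ξ‖ = 1 := by
  have h := resolvent_denom_ne_zero ξ
  have h2 : 1 - 2 * resolventSymbol ξ =
      -conj (1 + 2 * Real.pi * Complex.I * ξ : ℂ) / (1 + 2 * Real.pi * Complex.I * ξ) := by
    rw [resolventSymbol]
    field_simp
    simp [conj_two]
    ring
  rw [h2, norm_div, norm_neg, RCLike.norm_conj, div_self (norm_ne_zero_iff.2 h)]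

/-- The resolvent `(1 + ∂ₜ)⁻¹` on `L²(ℝ)`. -/
def timeResolvent : TimeL2 →L[ℂ] TimeL2 :=
  (Lp.fourierTransformₗᵢ ℝ ℂ).symm.toContinuousLinearEquiv.toContinuousLinearMap ∘L
    mulOp resolventSymbol measurable_resolventSymbol norm_resolventSymbol_le ∘L
      (Lp.fourierTransformₗᵢ ℝ ℂ).toContinuousLinearEquiv.toContinuousLinearMap

lemma fourier_timeResolvent (u : TimeL2) :
    𝓕 (timeResolvent u) =
      mulOp resolventSymbol measurable_resolventSymbol norm_resolventSymbol_le (𝓕 u) :=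
  (Lp.fourierTransformₗᵢ ℝ ℂ).apply_symm_apply _

lemma coeFn_fourier_timeResolvent (u : TimeL2) :
    (𝓕 (timeResolvent u) : TimeL2) =ᵐ[volume] fun ξ => resolventSymbol ξ * (𝓕 u : TimeL2) ξ := by
  rw [fourier_timeResolvent]
  exact coeFn_mulOp _ _ _ _

/-- Plancherel and the unimodular symbol. Accretivity of ∂ₜ enters the energy argument only in this
form. -/
lemma norm_cayley_le (u : TimeL2) : ‖u - (2 : ℂ) • timeResolvent u‖ ≤ ‖u‖ := by
  have h1 : 𝓕 (u - (2 : ℂ) • timeResolvent u) = 𝓕 u - (2 : ℂ) • (𝓕 (timeResolvent u) : TimeL2) := by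
    have := map_sub (Lp.fourierTransformₗᵢ ℝ ℂ) u ((2 : ℂ) • timeResolvent u)
    rw [map_smul] at this
    exact this
  rw [← Lp.norm_fourier_eq u, ← Lp.norm_fourier_eq (u - (2 : ℂ) • timeResolvent u), h1]
  refine Lp.norm_le_norm_of_ae_le ?_
  filter_upwards [coeFn_fourier_timeResolvent u,
    Lp.coeFn_sub (𝓕 u : TimeL2) ((2 : ℂ) • (𝓕 (timeResolvent u) : TimeL2)),
    Lp.coeFn_smul (2 : ℂ) (𝓕 (timeResolvent u) : TimeL2)] with ξ h1 h2 h3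
  rw [h2, Pi.sub_apply, h3, Pi.smul_apply, h1, smul_eq_mul, ← mul_assoc, ← one_sub_mul, norm_mul,
    norm_cayley_symbol, one_mul]

/-- The adjoint relation between the resolvent and `f ↦ f - f'`. -/
lemma inner_sub_deriv_timeResolvent (f : 𝓢(ℝ, ℂ)) (u : TimeL2) :
    inner ℂ (toL2 f - toL2 (deriv f)) (timeResolvent u) = inner ℂ (toL2 f) u := by
  have h0 : toL2 f - toL2 (deriv f) = toL2 (f - SchwartzMap.derivCLM ℂ ℂ f : 𝓢(ℝ, ℂ)) :=
    (toL2_sub (memLp_schwartz f) (memLp_schwartz (SchwartzMap.derivCLM ℂ ℂ f))).symm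
  rw [h0, ← Lp.inner_fourier_eq, ← Lp.inner_fourier_eq (toL2 f), fourier_toL2_schwartz,
    fourier_toL2_schwartz, inner_toL2 (memLp_schwartz _), inner_toL2 (memLp_schwartz _)]
  refine integral_congr_ae ?_
  filter_upwards [coeFn_fourier_timeResolvent u] with ξ h
  rw [h, schwartz_fourier_sub, fourier_schwartz_deriv,
    resolventSymbol]
  have := resolvent_denom_ne_zero ξ
  field_simp
  simp [conj_two]
  ring

/-- The identity 1/(1 - iτ) = (1 + τ²)⁻¹(1 + iτ) reduces the claim to powers of 1 + τ² and
polynomials. -/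
lemma hasTemperateGrowth_backwardSymbol :
    (fun ξ : ℝ => (1 - 2 * Real.pi * Complex.I * ξ : ℂ)⁻¹).HasTemperateGrowth := by
  have h1 : (fun ξ : ℝ => (1 - 2 * Real.pi * Complex.I * ξ : ℂ)⁻¹) = fun ξ : ℝ =>
      (((1 + ‖(2 * Real.pi) • ξ‖ ^ 2) ^ (-1 : ℝ) : ℝ) : ℂ) *
        (1 + 2 * Real.pi * Complex.I * ξ) := by
    ext ξ
    have h := resolvent_denom_ne_zero ξ
    have h' : (1 - 2 * Real.pi * Complex.I * ξ : ℂ) ≠ 0 := by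
      have := resolvent_denom_ne_zero (-ξ)
      push_cast at this
      rwa [mul_neg, ← sub_eq_add_neg] at this
    rw [Real.rpow_neg_one, smul_eq_mul, Real.norm_eq_abs, sq_abs, ← normSq_resolvent_denom,
      Complex.ofReal_inv, Complex.normSq_eq_conj_mul_self]
    have h3 : conj (1 + 2 * Real.pi * Complex.I * ξ : ℂ) = 1 - 2 * Real.pi * Complex.I * ξ := by
      simp [conj_two]
      ring
    rw [h3]
    field_simp
  rw [h1]
  have h4 : (fun ξ : ℝ => (1 + ‖(2 * Real.pi) • ξ‖ ^ 2) ^ (-1 : ℝ)).HasTemperateGrowth := by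
    have := (Function.hasTemperateGrowth_one_add_norm_sq_rpow ℝ (-1)).comp
      (((2 * Real.pi) • ContinuousLinearMap.id ℝ ℝ).hasTemperateGrowth)
    exact this
  have h5 : (fun ξ : ℝ => (((1 + ‖(2 * Real.pi) • ξ‖ ^ 2) ^ (-1 : ℝ) : ℝ) : ℂ)).HasTemperateGrowth :=
    Function.Complex.hasTemperateGrowth_ofReal.comp h4
  have h6 : (fun ξ : ℝ => (1 + 2 * Real.pi * Complex.I * ξ : ℂ)).HasTemperateGrowth :=
    (Function.HasTemperateGrowth.const 1).add
      ((Function.HasTemperateGrowth.const (2 * Real.pi * Complex.I)).mul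
        Function.Complex.hasTemperateGrowth_ofReal)
  exact h5.mul h6

/-- The symbol 1 - iτ of 1 - ∂ₜ has no real zero, so one may divide by it within the Schwartz space.
-/
lemma exists_schwartz_sub_deriv_eq (ψ : 𝓢(ℝ, ℂ)) : ∃ f : 𝓢(ℝ, ℂ), ∀ t, f t - deriv f t = ψ t := by
  let f : 𝓢(ℝ, ℂ) := 𝓕⁻ (SchwartzMap.smulLeftCLM ℂ
    (fun ξ : ℝ => (1 - 2 * Real.pi * Complex.I * ξ : ℂ)⁻¹) (𝓕 ψ))
  have hf : 𝓕 f = SchwartzMap.smulLeftCLM ℂ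
    (fun ξ : ℝ => (1 - 2 * Real.pi * Complex.I * ξ : ℂ)⁻¹) (𝓕 ψ) :=
    FourierTransform.fourier_fourierInv_eq _
  have h : f - SchwartzMap.derivCLM ℂ ℂ f = ψ := by
    apply (FourierTransform.fourierEquiv ℂ 𝓢(ℝ, ℂ)).injective
    rw [FourierTransform.fourierEquiv_apply, FourierTransform.fourierEquiv_apply]
    ext ξ
    rw [schwartz_fourier_sub, fourier_schwartz_deriv, hf,
      SchwartzMap.smulLeftCLM_apply_apply hasTemperateGrowth_backwardSymbol]
    have h' : (1 - 2 * Real.pi * Complex.I * ξ : ℂ) ≠ 0 := by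
      have := resolvent_denom_ne_zero (-ξ)
      push_cast at this
      rwa [mul_neg, ← sub_eq_add_neg] at this
    rw [smul_eq_mul, ← one_sub_mul, mul_inv_cancel_left₀ h']
  refine ⟨f, fun t => ?_⟩
  rw [← h]
  rfl

/-- A bounded solution of `f' = f` on a half-line `[b, ∞)` vanishes there. -/
lemma eq_zero_of_deriv_eq_self {f : 𝓢(ℝ, ℂ)} {b : ℝ} (h : ∀ t, b ≤ t → deriv f t = f t) :
    ∀ t, b ≤ t → f t = 0 := by
  intro t ht
  have h1 : ∀ s ∈ Ici t, HasDerivWithinAt (fun s : ℝ => Complex.exp (-s) * f s) 0 (Ici t) s := by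
    intro s hs
    have e1 : HasDerivAt (fun s : ℝ => Complex.exp (-s)) (-Complex.exp (-s)) s := by
      have := ((Complex.ofRealCLM.hasDerivAt (x := s)).neg).cexp
      simpa using this
    refine ((e1.fun_mul (f.hasDerivAt s)).congr_deriv ?_).hasDerivWithinAt
    rw [h s (ht.trans hs)]
    ring
  have h2 : ∀ s, t ≤ s → Complex.exp (-s) * f s = Complex.exp (-t) * f t := by
    intro s hs
    have := (convex_Ici t).norm_image_sub_le_of_norm_hasDerivWithin_le (C := 0) h1 (by simp)
      (self_mem_Ici (a := t)) (show s ∈ Ici t from hs)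
    simpa [sub_eq_zero] using this
  have h3 : Tendsto (fun s : ℝ => Complex.exp (-s) * f s) atTop (𝓝 0) := by
    obtain ⟨C, hC⟩ := f.decay 0 0
    have e : Tendsto (fun s : ℝ => Real.exp (-s) * C) atTop (𝓝 0) := by
      simpa using (Real.tendsto_exp_neg_atTop_nhds_zero).mul_const C
    refine squeeze_zero_norm (fun s => ?_) e
    rw [norm_mul, Complex.norm_exp]
    have := hC.2 s
    simp only [pow_zero, norm_iteratedFDeriv_zero, one_mul] at this
    simpa using mul_le_mul_of_nonneg_left this (Real.exp_pos (-s)).le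
  have h4 : Tendsto (fun s : ℝ => Complex.exp (-s) * f s) atTop (𝓝 (Complex.exp (-t) * f t)) :=
    tendsto_const_nhds.congr' ((eventually_ge_atTop t).mono fun s hs => (h2 s hs).symm)
  simpa [Complex.exp_ne_zero] using tendsto_nhds_unique h4 h3

/-- The backward equation `f - f' = ψ` has a Schwartz solution that vanishes wherever it must. -/
lemma exists_backward_solution {ψ : ℝ → ℝ} (hψ : ContDiff ℝ ∞ ψ) (hc : HasCompactSupport ψ)
    {a : ℝ} (hs : tsupport ψ ⊆ Iio a) :
    ∃ (f : 𝓢(ℝ, ℂ)) (b : ℝ), b < a ∧ (∀ t, b ≤ t → f t = 0) ∧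
      (∀ t, f t - deriv f t = ψ t) ∧
      ∀ u : TimeL2, inner ℂ (toL2 fun t => (ψ t : ℂ)) (timeResolvent u) = inner ℂ (toL2 f) u := by
  have hψ' : ContDiff ℝ ∞ (fun t => (ψ t : ℂ)) := Complex.ofRealCLM.contDiff.comp hψ
  have hc' : HasCompactSupport (fun t => (ψ t : ℂ)) :=
    hc.comp_left (g := fun x : ℝ => (x : ℂ)) Complex.ofReal_zero
  -- The strict gap b < a lets test functions built from `f` have closed support inside t < a.
  obtain ⟨b, hba, hb⟩ : ∃ b < a, ∀ t, b ≤ t → ψ t = 0 := by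
    rcases (tsupport ψ).eq_empty_or_nonempty with h | h
    · refine ⟨a - 1, by linarith, fun t _ => image_eq_zero_of_notMem_tsupport (by simp [h])⟩
    · obtain ⟨m, hm, hmax⟩ := (show IsCompact (tsupport ψ) from hc).exists_isMaxOn h
        continuousOn_id
      have hma : m < a := hs hm
      refine ⟨(m + a) / 2, by linarith, fun t ht => image_eq_zero_of_notMem_tsupport fun h' => ?_⟩
      have : t ≤ m := hmax h'
      linarith
  obtain ⟨f, hf⟩ := exists_schwartz_sub_deriv_eq (hc'.toSchwartzMap hψ')
  have hf' : ∀ t, f t - deriv f t = ψ t := hf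
  refine ⟨f, b, hba, eq_zero_of_deriv_eq_self fun t ht => ?_, hf', fun u => ?_⟩
  · have := hf' t
    rw [hb t ht, Complex.ofReal_zero, sub_eq_zero] at this
    exact this.symm
  · have h : toL2 (fun t => (ψ t : ℂ)) = toL2 f - toL2 (deriv f) := by
      simp only [← hf']
      exact toL2_sub (memLp_schwartz f) (memLp_schwartz (SchwartzMap.derivCLM ℂ ℂ f))
    rw [h, inner_sub_deriv_timeResolvent]

lemma memLp_of_continuous {ψ : ℝ → ℂ} (hψ : Continuous ψ) (hc : HasCompactSupport ψ) :
    MemLp ψ 2 (volume : Measure ℝ) := hψ.memLp_of_hasCompactSupport hc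

/-- A square-integrable function orthogonal to the test functions before time `a` vanishes there. -/
lemma past_eq_zero_of_inner {a : ℝ} {u : TimeL2}
    (h : ∀ ψ : ℝ → ℝ, ContDiff ℝ ∞ ψ → HasCompactSupport ψ → tsupport ψ ⊆ Iio a →
      inner ℂ (toL2 fun t => (ψ t : ℂ)) u = 0) : past a u = 0 := by
  rw [past_eq_zero_iff]
  have hu : LocallyIntegrable u volume := (Lp.memLp u).locallyIntegrable (by norm_num)
  refine isOpen_Iio.ae_eq_zero_of_integral_contDiff_smul_eq_zero (hu.locallyIntegrableOn _)
    fun ψ h1 h2 h3 => ?_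
  have hm : MemLp (fun t => (ψ t : ℂ)) 2 (volume : Measure ℝ) :=
    memLp_of_continuous (Complex.continuous_ofReal.comp h1.continuous)
      (h2.comp_left (g := fun x : ℝ => (x : ℂ)) Complex.ofReal_zero)
  have := h ψ h1 h2 h3
  rw [inner_toL2 hm] at this
  simpa [Complex.real_smul] using this

/-- Against a test function ψ supported before a, the resolvent moves to the other side and replaces
ψ by the backward solution f. That function vanishes after a, and u vanishes before a. -/
lemma past_timeResolvent_eq_zero {a : ℝ} {u : TimeL2} (hu : past a u = 0) :
    past a (timeResolvent u) = 0 := by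
  refine past_eq_zero_of_inner fun ψ h1 h2 h3 => ?_
  obtain ⟨f, b, hba, hb, -, hf⟩ := exists_backward_solution h1 h2 h3
  rw [hf, inner_toL2 (memLp_schwartz f)]
  rw [past_eq_zero_iff] at hu
  refine integral_eq_zero_of_ae ?_
  filter_upwards [hu] with t ht
  rcases lt_or_ge t a with h | h
  · simp [ht h]
  · simp [hb t (hba.le.trans h)]

/-- The resolvent is causal. -/
lemma past_timeResolvent (a : ℝ) (u : TimeL2) :
    past a (timeResolvent u) = past a (timeResolvent (past a u)) := by
  have h := past_timeResolvent_eq_zero (a := a) (u := u - past a u) (by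
    rw [map_sub, past_past, sub_self])
  rwa [map_sub, map_sub, sub_eq_zero] at h

/-! ### The energy argument -/

section Abstract

variable {H : Type*} [NormedAddCommGroup H] [InnerProductSpace ℂ H]

/-- A causal resolvent with contractive Cayley transform stays accretive on the past. -/
lemma re_inner_resolvent_nonneg {P R : H →L[ℂ] H} (hP : ∀ u, ‖P u‖ ≤ ‖u‖)
    (hR : ∀ u, ‖u - (2 : ℂ) • R u‖ ≤ ‖u‖) (hPP : ∀ u, P (P u) = P u)
    (hPR : ∀ u, P (R u) = P (R (P u))) (u : H) :
    0 ≤ (inner ℂ (P (R u)) (P (u - R u))).re := by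
  set p := P u with hp
  set q := P (R u) with hq
  -- Causality shows that P(1 - 2R) maps p to p - 2q, so the contraction property survives the
  -- projection. The claim is then ‖p‖² - ‖p - 2q‖² = 4 Re⟨q, p - q⟩ ≥ 0.
  have h1 : ‖p - (2 : ℂ) • q‖ ≤ ‖p‖ := by
    have : p - (2 : ℂ) • q = P (p - (2 : ℂ) • R p) := by
      rw [map_sub, map_smul, hp, hPP, ← hPR]
    rw [this]
    exact (hP _).trans (hR _)
  have h2 : ‖p - (2 : ℂ) • q‖ ^ 2 = ‖p‖ ^ 2 - 4 * (inner ℂ q (p - q)).re := by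
    rw [← inner_self_eq_norm_sq (𝕜 := ℂ), ← inner_self_eq_norm_sq (𝕜 := ℂ) p]
    have h3 : (inner ℂ p q).re = (inner ℂ q p).re := by
      rw [← inner_conj_symm, Complex.conj_re]
    simp only [inner_sub_left, inner_sub_right, inner_smul_left, inner_smul_right]
    simp [h3]
    ring
  rw [map_sub]
  nlinarith [norm_nonneg (p - (2 : ℂ) • q), norm_nonneg p]

/-- Uniqueness for `V'' = κ⁻¹ ∂ₜ V` on the past, with `V = 0` and `V' = 0` at the two ends; the
equation is stated after applying the resolvent `R = (1 + ∂ₜ)⁻¹`. -/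
lemma past_eq_zero_of_resolvent_equation {P R : H →L[ℂ] H} (hP : ∀ u, ‖P u‖ ≤ ‖u‖)
    (hR : ∀ u, ‖u - (2 : ℂ) • R u‖ ≤ ‖u‖) (hPP : ∀ u, P (P u) = P u)
    (hPR : ∀ u, P (R u) = P (R (P u))) {κ : ℂ} (hκ : 0 < κ.re) {L : ℝ} (hL : 0 < L)
    {V V' : ℝ → H}
    (hV : ∀ x ∈ Icc 0 L, HasDerivWithinAt V (V' x) (Icc 0 L) x)
    (hW : ∀ x ∈ Icc 0 L, HasDerivWithinAt (fun y => P (R (V' y)))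
      (κ⁻¹ • P (V x - R (V x))) (Icc 0 L) x)
    (h0 : P (V 0) = 0) (h1 : P (V' L) = 0) : ∀ x ∈ Icc 0 L, P (V x) = 0 := by
  have hκ0 : κ ≠ 0 := fun h => by simp [h] at hκ
  have hD : ∀ x ∈ Icc 0 L, HasDerivWithinAt (fun y => P (R (V y))) (P (R (V' x))) (Icc 0 L) x :=
    fun x hx => ((P.comp R).restrictScalars ℝ).hasFDerivAt.comp_hasDerivWithinAt x (hV x hx)
  -- The factor κ cancels the κ⁻¹ of the equation, so both terms of the derivative are nonnegative:
  -- one by Re κ > 0, the other by accretivity.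
  let f : ℝ → ℝ := fun x => (κ * inner ℂ (P (R (V x))) (P (R (V' x)))).re
  have hf : ∀ x ∈ Icc 0 L, HasDerivWithinAt f
      (κ.re * ‖P (R (V' x))‖ ^ 2 + (inner ℂ (P (R (V x))) (P (V x - R (V x)))).re)
      (Icc 0 L) x := by
    intro x hx
    have h2 := (((hD x hx).inner ℂ (hW x hx)).const_mul κ)
    have h3 := Complex.reCLM.hasFDerivAt.comp_hasDerivWithinAt x h2
    refine h3.congr_deriv ?_
    have e : inner ℂ (P (R (V' x))) (P (R (V' x))) = ((‖P (R (V' x))‖ ^ 2 : ℝ) : ℂ) := by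
      rw [inner_self_eq_norm_sq_to_K]
      norm_cast
    rw [inner_smul_right, mul_add, mul_inv_cancel_left₀ hκ0, e]
    simp only [Complex.reCLM_apply, Complex.add_re, Complex.re_mul_ofReal]
    ring
  have hnn : ∀ x, 0 ≤ (inner ℂ (P (R (V x))) (P (V x - R (V x)))).re := fun x =>
    re_inner_resolvent_nonneg hP hR hPP hPR (V x)
  have hmono : MonotoneOn f (Icc 0 L) := by
    refine monotoneOn_of_deriv_nonneg (convex_Icc 0 L) (fun x hx => (hf x hx).continuousWithinAt)
      (fun x hx => ?_) (fun x hx => ?_)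
    · rw [interior_Icc] at *
      exact ((hf x (Ioo_subset_Icc_self hx)).hasDerivAt
        (Icc_mem_nhds hx.1 hx.2)).differentiableAt.differentiableWithinAt
    · rw [interior_Icc] at *
      rw [((hf x (Ioo_subset_Icc_self hx)).hasDerivAt (Icc_mem_nhds hx.1 hx.2)).deriv]
      have := hnn x
      positivity
  have hf0 : f 0 = 0 := by
    simp only [f]
    rw [hPR, h0]
    simp
  have hfL : f L = 0 := by
    simp only [f]
    rw [hPR (V' L), h1]
    simp
  have m0 : (0 : ℝ) ∈ Icc 0 L := ⟨le_rfl, hL.le⟩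
  have mL : L ∈ Icc 0 L := ⟨hL.le, le_rfl⟩
  have hfz : ∀ x ∈ Icc 0 L, f x = 0 := fun x hx =>
    le_antisymm (hfL ▸ hmono hx mL hx.2) (hf0 ▸ hmono m0 hx hx.1)
  have hU := uniqueDiffOn_Icc hL
  have hV'0 : ∀ x ∈ Icc 0 L, P (R (V' x)) = 0 := by
    intro x hx
    have h4 : HasDerivWithinAt f 0 (Icc 0 L) x :=
      (hasDerivWithinAt_const x (Icc 0 L) (0 : ℝ)).congr hfz (hfz x hx)
    have h5 := (hU x hx).eq_deriv _ (hf x hx) h4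
    have h6 : κ.re * ‖P (R (V' x))‖ ^ 2 = 0 :=
      le_antisymm (by linarith [hnn x]) (by positivity)
    simpa [hκ.ne'] using h6
  -- Now PRV has zero derivative, and at x = 0 it vanishes by causality. Differentiating PRV' = 0
  -- then gives P(V - RV) = 0, that is PV = 0.
  have hRV0 : ∀ x ∈ Icc 0 L, P (R (V x)) = 0 := by
    intro x hx
    have := (convex_Icc 0 L).norm_image_sub_le_of_norm_hasDerivWithin_le (C := 0) hD
      (fun y hy => by simp [hV'0 y hy]) m0 hx
    simp only [zero_mul, norm_le_zero_iff, sub_eq_zero] at this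
    rw [this, hPR, h0]
    simp
  intro x hx
  have h4 : HasDerivWithinAt (fun y => P (R (V' y))) 0 (Icc 0 L) x :=
    (hasDerivWithinAt_const x (Icc 0 L) (0 : H)).congr hV'0 (hV'0 x hx)
  have h5 := (hU x hx).eq_deriv _ (hW x hx) h4
  rw [map_sub, hRV0 x hx, sub_zero] at h5
  simpa [hκ0] using h5

end Abstract

/-! ### From the weak equation to the resolvent equation; uniqueness -/

lemma hasDerivWithinAt_integral_Icc {E : Type*} [NormedAddCommGroup E] [NormedSpace ℝ E]
    [CompleteSpace E] {Q : ℝ → E} {L : ℝ} (hL : 0 ≤ L) (hQ : ContinuousOn Q (Icc 0 L)) :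
    ∀ x ∈ Icc 0 L, HasDerivWithinAt (fun y => ∫ t in (0 : ℝ)..y, Q t) (Q x) (Icc 0 L) x := by
  intro x hx
  let Q' : ℝ → E := IccExtend hL ((Icc 0 L).domRestrict Q)
  have hQ' : Continuous Q' := (continuousOn_iff_continuous_domRestrict.1 hQ).Icc_extend' (h := hL)
  have hE : ∀ y ∈ Icc 0 L, Q' y = Q y := fun y hy => IccExtend_of_mem hL _ hy
  have h1 := (hQ'.integral_hasStrictDerivAt 0 x).hasDerivAt.hasDerivWithinAt (s := Icc 0 L)
  rw [hE x hx] at h1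
  have h2 : ∀ y ∈ Icc 0 L, ∫ t in (0 : ℝ)..y, Q t = ∫ t in (0 : ℝ)..y, Q' t := fun y hy => by
    refine intervalIntegral.integral_congr fun t ht => ?_
    rw [uIcc_of_le hy.1] at ht
    exact (hE t ⟨ht.1, ht.2.trans hy.2⟩).symm
  exact h1.congr h2 (h2 x hx)

/-- A compactly supported smooth function on `(0, L)` with zero integral has a compactly supported
smooth primitive. -/
lemma exists_primitive_of_integral_eq_zero {σ : ℝ → ℝ} {L : ℝ} (hσ : ContDiff ℝ ∞ σ)
    (hc : HasCompactSupport σ) (hs : tsupport σ ⊆ Ioo 0 L) (h0 : ∫ x, σ x = 0) :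
    ∃ η : ℝ → ℝ, ContDiff ℝ ∞ η ∧ HasCompactSupport η ∧ tsupport η ⊆ Ioo 0 L ∧ deriv η = σ := by
  have hd : ∀ x, HasDerivAt (fun y => ∫ t in (0 : ℝ)..y, σ t) (σ x) x := fun x =>
    (hσ.continuous.integral_hasStrictDerivAt 0 x).hasDerivAt
  have hderiv : deriv (fun y => ∫ t in (0 : ℝ)..y, σ t) = σ := funext fun x => (hd x).deriv
  rcases (tsupport σ).eq_empty_or_nonempty with h | h
  · refine ⟨0, contDiff_const, HasCompactSupport.zero, by simp [tsupport], ?_⟩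
    ext x
    rw [image_eq_zero_of_notMem_tsupport (f := σ) (by simp [h])]
    simp
  have hK : IsCompact (tsupport σ) := hc
  obtain ⟨l, hl, hmin⟩ := hK.exists_isMinOn h continuousOn_id
  obtain ⟨r, hr, hmax⟩ := hK.exists_isMaxOn h continuousOn_id
  have hzl : ∀ x, x < l → σ x = 0 := fun x hx => image_eq_zero_of_notMem_tsupport fun h' =>
    absurd (hmin h') (not_le.2 hx)
  have hzr : ∀ x, r < x → σ x = 0 := fun x hx => image_eq_zero_of_notMem_tsupport fun h' =>
    absurd (hmax h') (not_le.2 hx)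
  have hl0 := (hs hl).1
  have hrL := (hs hr).2
  have hsub : tsupport (fun y => ∫ t in (0 : ℝ)..y, σ t) ⊆ Icc l r := by
    refine closure_minimal (fun y hy => ?_) isClosed_Icc
    by_contra hy'
    apply hy
    rcases lt_or_ge y l with h1 | h1
    · refine intervalIntegral.integral_zero_ae (Eventually.of_forall fun t ht => hzl t ?_)
      rcases le_total 0 y with h2 | h2
      · rw [uIoc_of_le h2] at ht
        linarith [ht.2]
      · rw [uIoc_of_ge h2] at ht
        linarith [ht.2]
    · have h2 : r < y := by
        by_contra h3
        exact hy' ⟨h1, not_lt.1 h3⟩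
      have hint := hσ.continuous.integrable_of_hasCompactSupport (μ := volume) hc
      have : ∫ t in (0 : ℝ)..y, σ t = ∫ t, σ t := by
        refine intervalIntegral.integral_eq_integral_of_support_subset fun t ht => ?_
        have := hs (subset_tsupport σ ht)
        exact ⟨this.1, not_lt.1 fun h3 => ht (hzr t (h2.trans h3))⟩
      exact this.trans h0
  refine ⟨_, ?_, ?_, hsub.trans fun x hx => ⟨hl0.trans_le hx.1, hx.2.trans_lt hrL⟩, hderiv⟩
  · rw [contDiff_infty_iff_deriv, hderiv]
    exact ⟨fun x => (hd x).differentiableAt, hσ⟩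
  · exact HasCompactSupport.of_support_subset_isCompact isCompact_Icc
      ((subset_tsupport _).trans hsub)

/-- The lemma of du Bois-Reymond on an interval. -/
lemma eq_of_integral_deriv_mul_eq_zero {F : ℝ → ℂ} {L : ℝ} (hL : 0 < L)
    (hF : ContinuousOn F (Icc 0 L))
    (h : ∀ η : ℝ → ℝ, ContDiff ℝ ∞ η → HasCompactSupport η → tsupport η ⊆ Ioo 0 L →
      ∫ x in Ioo 0 L, ((deriv η x : ℝ) : ℂ) * F x = 0) :
    ∀ x ∈ Icc 0 L, F x = F 0 := by
  -- Any test function of integral one in (0, L) would do; it serves to remove the mean of the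
  -- others.
  let β : ContDiffBump (L / 2) := ⟨L / 8, L / 4, by linarith, by linarith⟩
  let ρ₀ : ℝ → ℝ := β.normed volume
  have hρ₀ : ContDiff ℝ ∞ ρ₀ := β.contDiff_normed
  have hρ₀c : HasCompactSupport ρ₀ := β.hasCompactSupport_normed
  have hρ₀s : tsupport ρ₀ ⊆ Ioo 0 L := by
    simp only [ρ₀]
    rw [β.tsupport_normed_eq, Real.closedBall_eq_Icc, show β.rOut = L / 4 from rfl]
    exact fun x hx => ⟨by linarith [hx.1], by linarith [hx.2]⟩
  have hρ₀i : ∫ x, ρ₀ x = 1 := β.integral_normed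
  have hIoo : ∀ ρ : ℝ → ℝ, Continuous ρ →
      IntegrableOn (fun x => (ρ x : ℂ) * F x) (Ioo 0 L) := fun ρ hρ => by
    have : ContinuousOn (fun x => (ρ x : ℂ) * F x) (Icc 0 L) :=
      (Complex.continuous_ofReal.comp hρ).continuousOn.mul hF
    exact this.integrableOn_Icc.mono_set Ioo_subset_Icc_self
  have hI : ∀ ρ : ℝ → ℝ, tsupport ρ ⊆ Ioo 0 L → ∫ x in Ioo 0 L, (ρ x : ℂ) = ((∫ x, ρ x : ℝ) : ℂ) := by
    intro ρ hρ
    rw [← integral_complex_ofReal]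
    refine setIntegral_eq_integral_of_forall_compl_eq_zero fun x hx => ?_
    rw [image_eq_zero_of_notMem_tsupport fun h' => hx (hρ h'), Complex.ofReal_zero]
  set c : ℂ := ∫ x in Ioo 0 L, (ρ₀ x : ℂ) * F x with hcdef
  have hae : ∀ᵐ x, x ∈ Ioo 0 L → F x - c = 0 := by
    refine isOpen_Ioo.ae_eq_zero_of_integral_contDiff_smul_eq_zero ?_ fun ρ h1 h2 h3 => ?_
    · exact ((hF.mono Ioo_subset_Icc_self).sub continuousOn_const).locallyIntegrableOn
        measurableSet_Ioo
    have hm := h1.continuous.integrable_of_hasCompactSupport (μ := volume) h2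
    have hm0 := hρ₀.continuous.integrable_of_hasCompactSupport (μ := volume) hρ₀c
    -- Subtracting (∫ρ)ρ₀ leaves a test function of zero integral, hence a derivative η'. The
    -- hypothesis for η reads ∫ρF = (∫ρ)c.
    have hsub : tsupport (fun x => ρ x - (∫ y, ρ y) * ρ₀ x) ⊆ Ioo 0 L :=
      (tsupport_sub _ _).trans (union_subset h3 (tsupport_mul_subset_right.trans hρ₀s))
    have hzero : ∫ x, (ρ x - (∫ y, ρ y) * ρ₀ x) = 0 := by
      rw [integral_sub hm (hm0.const_mul _), integral_const_mul, hρ₀i, mul_one, sub_self]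
    obtain ⟨η, e1, e2, e3, e4⟩ := exists_primitive_of_integral_eq_zero
      (h1.sub (contDiff_const.mul hρ₀)) (h2.sub hρ₀c.mul_left) hsub hzero
    have h5 := h η e1 e2 e3
    rw [e4] at h5
    have h6 : ∫ x, ρ x • (F x - c) = ∫ x in Ioo 0 L, ((ρ x : ℂ) * F x - ρ x * c) := by
      rw [← setIntegral_eq_integral_of_forall_compl_eq_zero (s := Ioo 0 L)]
      · simp only [Complex.real_smul, mul_sub]
      · intro x hx
        rw [image_eq_zero_of_notMem_tsupport fun h' => hx (h3 h'), zero_smul]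
    have h7 : IntegrableOn (fun x => (ρ x : ℂ) * c) (Ioo 0 L) :=
      (hm.ofReal.mul_const c).integrableOn
    rw [h6, integral_sub (hIoo ρ h1.continuous) h7, integral_mul_const, hI ρ h3]
    rw [← h5]
    have h8 : ∀ x, ((ρ x - (∫ y, ρ y) * ρ₀ x : ℝ) : ℂ) * F x =
        (ρ x : ℂ) * F x - ((∫ y, ρ y : ℝ) : ℂ) * ((ρ₀ x : ℂ) * F x) := fun x => by
      push_cast
      ring
    simp only [h8]
    rw [integral_sub (hIoo ρ h1.continuous) ((hIoo ρ₀ hρ₀.continuous).const_mul _),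
      integral_const_mul]
  have hEq : EqOn F (fun _ => c) (Icc 0 L) := by
    refine Measure.eqOn_Icc_of_ae_eq volume hL.ne ?_ hF continuousOn_const
    rw [← restrict_Ioo_eq_restrict_Icc]
    exact (ae_restrict_iff' measurableSet_Ioo).2 (hae.mono fun x hx hx' => sub_eq_zero.1 (hx hx'))
  intro x hx
  rw [hEq hx, hEq ⟨le_rfl, hL.le⟩]

/-- A function whose second derivative is `κ⁻¹ a` in the sense of distributions. -/
lemma deriv_eq_integral_of_weak {a b b' : ℝ → ℂ} {κ : ℂ} {L : ℝ} (hL : 0 < L)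
    (ha : ContinuousOn a (Icc 0 L)) (hb' : ContinuousOn b' (Icc 0 L))
    (hb : ∀ x ∈ Icc 0 L, HasDerivWithinAt b (b' x) (Icc 0 L) x)
    (h : ∀ η : ℝ → ℝ, ContDiff ℝ ∞ η → HasCompactSupport η → tsupport η ⊆ Ioo 0 L →
      ∫ x in Ioo 0 L, (κ * ((deriv (deriv η) x : ℝ) : ℂ) * b x - (η x : ℂ) * a x) = 0) :
    ∀ x ∈ Icc 0 L, κ * (b' x - b' 0) = ∫ t in (0 : ℝ)..x, a t := by
  have hA := hasDerivWithinAt_integral_Icc hL.le ha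
  set A : ℝ → ℂ := fun y => ∫ t in (0 : ℝ)..y, a t with hAdef
  have hAc : ContinuousOn A (Icc 0 L) := fun x hx => (hA x hx).continuousWithinAt
  have hbc : ContinuousOn b (Icc 0 L) := fun x hx => (hb x hx).continuousWithinAt
  have key := eq_of_integral_deriv_mul_eq_zero hL (F := fun x => A x - κ * b' x)
    (hAc.sub (continuousOn_const.mul hb')) ?_
  · intro x hx
    have := key x hx
    have hA0 : A 0 = 0 := by simp [hAdef]
    simp only [hA0] at this
    change _ = A x
    linear_combination -this
  intro η h1 h2 h3
  have hη1 : ContDiff ℝ ∞ (deriv η) := (contDiff_infty_iff_deriv.1 h1).2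
  have hη2 : ContDiff ℝ ∞ (deriv (deriv η)) := (contDiff_infty_iff_deriv.1 hη1).2
  have c0 : Continuous fun x => (η x : ℂ) := Complex.continuous_ofReal.comp h1.continuous
  have c1 : Continuous fun x => ((deriv η x : ℝ) : ℂ) := Complex.continuous_ofReal.comp hη1.continuous
  have c2 : Continuous fun x => ((deriv (deriv η) x : ℝ) : ℂ) :=
    Complex.continuous_ofReal.comp hη2.continuous
  have hz : ∀ x ∉ Ioo 0 L, η x = 0 ∧ deriv η x = 0 := fun x hx =>
    ⟨image_eq_zero_of_notMem_tsupport fun h' => hx (h3 h'),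
      image_eq_zero_of_notMem_tsupport fun h' => hx (h3 (tsupport_deriv_subset h'))⟩
  -- D is the derivative of κη'b - ηA, which vanishes at both ends. Subtracting D from the weak
  -- integrand leaves η'(A - κb').
  let D : ℝ → ℂ := fun x => κ * (((deriv (deriv η) x : ℝ) : ℂ) * b x + ((deriv η x : ℝ) : ℂ) * b' x) -
    (((deriv η x : ℝ) : ℂ) * A x + η x * a x)
  have hDc : ContinuousOn D (Icc 0 L) :=
    (continuousOn_const.mul ((c2.continuousOn.mul hbc).add (c1.continuousOn.mul hb'))).sub
      ((c1.continuousOn.mul hAc).add (c0.continuousOn.mul ha))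
  have hD : ∫ x in (0 : ℝ)..L, D x = 0 := by
    have := intervalIntegral.integral_eq_sub_of_hasDerivAt_of_le (f' := D) hL.le
      (f := fun x => κ * (deriv η x * b x) - η x * A x)
      ((continuousOn_const.mul (c1.continuousOn.mul hbc)).sub (c0.continuousOn.mul hAc))
      (fun x hx => ?_) (hDc.intervalIntegrable_of_Icc hL.le)
    · rw [this, (hz 0 (by simp)).1, (hz 0 (by simp)).2, (hz L (by simp)).1, (hz L (by simp)).2]
      simp
    · have hN : Icc 0 L ∈ 𝓝 x := Icc_mem_nhds hx.1 hx.2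
      have hx' := Ioo_subset_Icc_self hx
      have d1 : HasDerivAt (fun x => ((deriv η x : ℝ) : ℂ)) ((deriv (deriv η) x : ℝ) : ℂ) x :=
        ((hη1.differentiable (by simp)) x).hasDerivAt.ofReal_comp
      have d0 : HasDerivAt (fun x => (η x : ℂ)) ((deriv η x : ℝ) : ℂ) x :=
        ((h1.differentiable (by simp)) x).hasDerivAt.ofReal_comp
      exact ((d1.fun_mul ((hb x hx').hasDerivAt hN)).const_mul κ).fun_sub
        (d0.fun_mul ((hA x hx').hasDerivAt hN))
  have h5 := h η h1 h2 h3
  rw [← integral_Ioc_eq_integral_Ioo, ← intervalIntegral.integral_of_le hL.le] at h5 ⊢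
  have hc5 : ContinuousOn (fun x => κ * ((deriv (deriv η) x : ℝ) : ℂ) * b x - (η x : ℂ) * a x)
      (Icc 0 L) :=
    ((continuousOn_const.mul c2.continuousOn).mul hbc).sub (c0.continuousOn.mul ha)
  calc ∫ x in (0 : ℝ)..L, ((deriv η x : ℝ) : ℂ) * (A x - κ * b' x)
      = ∫ x in (0 : ℝ)..L, ((κ * ((deriv (deriv η) x : ℝ) : ℂ) * b x - (η x : ℂ) * a x) - D x) := by
        congr 1
        ext x
        simp only [D]
        ring
    _ = 0 := by
        rw [intervalIntegral.integral_sub (hc5.intervalIntegrable_of_Icc hL.le)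
          (hDc.intervalIntegrable_of_Icc hL.le), h5, hD, sub_zero]

lemma inner_extendTime {T : ℝ} {f : ℝ → ℂ} (hf : MemLp f 2 (volume : Measure ℝ))
    (u : TimeL2On T) :
    inner ℂ (toL2 f) (extendTime T u) = ∫ t in Ioo 0 T, conj (f t) * u t := by
  rw [inner_toL2 hf, ← integral_indicator measurableSet_Ioo]
  refine integral_congr_ae ?_
  filter_upwards [coeFn_extendTime T u] with t ht
  rw [ht]
  by_cases h : t ∈ Ioo 0 T <;> simp [h]

/-- Backward solutions need not have compact support towards t = -∞. The cutoff provides it and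
changes neither them nor their derivatives on (0, T). -/
lemma exists_cutoff (T : ℝ) (hT : 0 < T) :
    ∃ χ : ℝ → ℝ, ContDiff ℝ ∞ χ ∧ HasCompactSupport χ ∧ ∀ t ∈ Ioo 0 T, χ =ᶠ[𝓝 t] 1 := by
  let β : ContDiffBump (0 : ℝ) := ⟨T, 2 * T, hT, by linarith⟩
  refine ⟨β, β.contDiff, β.hasCompactSupport, fun t ht => ?_⟩
  refine β.eventuallyEq_one_of_mem_ball ?_
  rw [Real.ball_eq_Ioo, show β.rIn = T from rfl]
  exact ⟨by linarith [ht.1, ht.2], by linarith [ht.2]⟩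

/-- The weak equation tested against a product of a test function in space and a solution of the
backward equation in time. -/
lemma IsReducedSolution.integral_inner_eq_zero {ν α L T : ℝ} (hT : 0 < T) {g h : TimeL2}
    {v vx : ℝ → TimeL2On T} (hsol : IsReducedSolution ν α L T g h v vx)
    {ψ : ℝ → ℝ} (hψ : ContDiff ℝ ∞ ψ) (hψc : HasCompactSupport ψ) (hψs : tsupport ψ ⊆ Iio T)
    {η : ℝ → ℝ} (hη : ContDiff ℝ ∞ η) (hηc : HasCompactSupport η) (hηs : tsupport η ⊆ Ioo 0 L) :
    ∫ x in Ioo 0 L, (((ν : ℂ) + Complex.I * α) * ((deriv (deriv η) x : ℝ) : ℂ) *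
        inner ℂ (toL2 fun t => (ψ t : ℂ)) (timeResolvent (extendTime T (v x))) -
      (η x : ℂ) * inner ℂ (toL2 fun t => (ψ t : ℂ))
        (extendTime T (v x) - timeResolvent (extendTime T (v x)))) = 0 := by
  obtain ⟨f, b, hbT, hfb, hfψ, hfR⟩ := exists_backward_solution hψ hψc hψs
  obtain ⟨χ, hχ, hχc, hχ1⟩ := exists_cutoff T hT
  have hη1 : ContDiff ℝ ∞ (deriv η) := (contDiff_infty_iff_deriv.1 hη).2
  have hψ2 : MemLp (fun t => (ψ t : ℂ)) 2 (volume : Measure ℝ) :=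
    memLp_of_continuous (Complex.continuous_ofReal.comp hψ.continuous)
      (hψc.comp_left (g := fun x : ℝ => (x : ℂ)) Complex.ofReal_zero)
  have hf'2 : MemLp (deriv f) 2 (volume : Measure ℝ) :=
    memLp_schwartz (SchwartzMap.derivCLM ℂ ℂ f)
  -- Here f = R*ψ, so f' = f - ψ = -(1 - R*)ψ.
  have hderiv : ∀ u : TimeL2, inner ℂ (toL2 (deriv f)) u =
      - inner ℂ (toL2 fun t => (ψ t : ℂ)) (u - timeResolvent u) := by
    intro u
    have h1 : toL2 (deriv f) = toL2 f - toL2 (fun t => (ψ t : ℂ)) := by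
      rw [← toL2_sub (memLp_schwartz f) hψ2]
      congr 1
      ext t
      rw [← hfψ]
      ring
    rw [h1, inner_sub_left, ← hfR, inner_sub_right]
    ring
  -- The weak form is bilinear while the inner product is conjugate-linear in its first slot, hence
  -- the conjugate. No vanishing at t = 0 is imposed, and this is how the zero initial condition is
  -- used.
  let φ : ℝ × ℝ → ℂ := fun p => (η p.1 : ℂ) * (conj (f p.2) * (χ p.2 : ℂ))
  have hφ : ContDiff ℝ ∞ φ := by
    have e1 : ContDiff ℝ ∞ fun p : ℝ × ℝ => (η p.1 : ℂ) :=
      Complex.ofRealCLM.contDiff.comp (hη.comp contDiff_fst)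
    have e2 : ContDiff ℝ ∞ fun p : ℝ × ℝ => (χ p.2 : ℂ) :=
      Complex.ofRealCLM.contDiff.comp (hχ.comp contDiff_snd)
    have e3 : ContDiff ℝ ∞ fun p : ℝ × ℝ => conj (f p.2) :=
      Complex.conjCLE.contDiff.comp (f.smooth'.comp contDiff_snd)
    exact e1.mul (e3.mul e2)
  have hsub : Function.support φ ⊆ tsupport η ×ˢ (tsupport χ ∩ Iic b) := by
    intro p hp
    have h1 : η p.1 ≠ 0 := fun h => hp (by simp [φ, h])
    have h2 : χ p.2 ≠ 0 := fun h => hp (by simp [φ, h])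
    refine ⟨subset_tsupport _ h1, subset_tsupport _ h2, ?_⟩
    by_contra h3
    exact hp (by simp [φ, hfb p.2 (not_le.1 h3).le])
  have hK : IsCompact (tsupport η ×ˢ (tsupport χ ∩ Iic b)) :=
    IsCompact.prod hηc (IsCompact.inter_right hχc isClosed_Iic)
  have hts : tsupport φ ⊆ tsupport η ×ˢ (tsupport χ ∩ Iic b) :=
    closure_minimal hsub hK.isClosed
  have key := hsol.equation φ hφ (HasCompactSupport.of_support_subset_isCompact hK hsub)
    (hts.trans (prod_mono hηs fun t ht => lt_of_le_of_lt ht.2 hbT))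
  rw [← key]
  refine setIntegral_congr_fun measurableSet_Ioo fun x _ => ?_
  have hχt : ∀ t ∈ Ioo 0 T, (χ t : ℂ) = 1 := fun t ht => by simp [(hχ1 t ht).self_of_nhds]
  have h1 : ∀ t ∈ Ioo 0 T, deriv (fun t' => φ (x, t')) t = (η x : ℂ) * conj (deriv f t) := by
    intro t ht
    have e1 : (fun t' => φ (x, t')) =ᶠ[𝓝 t] fun t' => (η x : ℂ) * conj (f t') := by
      filter_upwards [hχ1 t ht] with t' ht'
      simp [φ, ht']
    rw [e1.deriv_eq]
    have e2 : HasDerivAt (fun t' => conj (f t')) (conj (deriv f t)) t :=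
      (Complex.conjCLE : ℂ →L[ℝ] ℂ).hasFDerivAt.comp_hasDerivAt t (f.hasDerivAt t)
    exact (e2.const_mul _).deriv
  have h2 : ∀ t ∈ Ioo 0 T, iteratedDeriv 2 (fun x' => φ (x', t)) x =
      ((deriv (deriv η) x : ℝ) : ℂ) * conj (f t) := by
    intro t ht
    have d0 : ∀ y, HasDerivAt (fun x => (η x : ℂ)) ((deriv η y : ℝ) : ℂ) y := fun y =>
      ((hη.differentiable (by simp)) y).hasDerivAt.ofReal_comp
    have d1 : HasDerivAt (fun x => ((deriv η x : ℝ) : ℂ)) ((deriv (deriv η) x : ℝ) : ℂ) x :=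
      ((hη1.differentiable (by simp)) x).hasDerivAt.ofReal_comp
    have e1 : (fun x' => φ (x', t)) = fun x' => (η x' : ℂ) * conj (f t) := by
      ext x'
      simp [φ, hχt t ht]
    rw [iteratedDeriv_succ, iteratedDeriv_one, e1]
    have e2 : deriv (fun x' => (η x' : ℂ) * conj (f t)) =
        fun x' => ((deriv η x' : ℝ) : ℂ) * conj (f t) := by
      ext y
      exact ((d0 y).mul_const _).deriv
    rw [e2]
    exact (d1.mul_const _).deriv
  have hint : ∀ F : ℝ → ℂ, MemLp F 2 (volume : Measure ℝ) →
      Integrable (fun t => conj (F t) * v x t) (volume.restrict (Ioo 0 T)) := fun F hF =>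
    MemLp.integrable_mul ((hF.restrict (Ioo 0 T)).star) (Lp.memLp (v x))
  have h3 : ∫ t in Ioo 0 T, v x t * (deriv (fun t' => φ (x, t')) t +
      ((ν : ℂ) + Complex.I * α) * iteratedDeriv 2 (fun x' => φ (x', t)) x) =
      ∫ t in Ioo 0 T, ((η x : ℂ) * (conj (deriv f t) * v x t) +
        ((ν : ℂ) + Complex.I * α) * ((deriv (deriv η) x : ℝ) : ℂ) * (conj (f t) * v x t)) := by
    refine setIntegral_congr_fun measurableSet_Ioo fun t ht => ?_
    rw [h1 t ht, h2 t ht]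
    ring
  rw [h3, integral_add ((hint _ hf'2).const_mul _) ((hint _ (memLp_schwartz f)).const_mul _),
    integral_const_mul, integral_const_mul, ← inner_extendTime hf'2,
    ← inner_extendTime (memLp_schwartz f), hderiv, hfR]
  ring

lemma IsReducedSolution.continuousOn {ν α L T : ℝ} {g h : TimeL2}
    {v vx : ℝ → TimeL2On T} (hsol : IsReducedSolution ν α L T g h v vx) :
    ContinuousOn v (Icc 0 L) := fun x hx => (hsol.hasDeriv x hx).continuousWithinAt

/-- The weak equation in the form `(R v_x)_x = κ⁻¹ (v - R v)` before time `T`. -/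
lemma IsReducedSolution.resolvent_equation {ν α L T : ℝ} (hν : 0 < ν) (hL : 0 < L) (hT : 0 < T)
    {g h : TimeL2} {v vx : ℝ → TimeL2On T} (hsol : IsReducedSolution ν α L T g h v vx) :
    ∀ x ∈ Icc 0 L, HasDerivWithinAt (fun y => past T (timeResolvent (extendTime T (vx y))))
      (((ν : ℂ) + Complex.I * α)⁻¹ •
        past T (extendTime T (v x) - timeResolvent (extendTime T (v x)))) (Icc 0 L) x := by
  set κ : ℂ := (ν : ℂ) + Complex.I * α with hκdef
  have hκ : κ ≠ 0 := fun h => by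
    have := congrArg Complex.re h
    simp [hκdef] at this
    exact hν.ne' this
  set R := timeResolvent
  set E := extendTime T
  have hQ : ContinuousOn (fun x => E (v x) - R (E (v x))) (Icc 0 L) :=
    (E.continuous.comp_continuousOn hsol.continuousOn).sub
      ((R.comp E).continuous.comp_continuousOn hsol.continuousOn)
  have hRx : ContinuousOn (fun x => R (E (vx x))) (Icc 0 L) :=
    (R.comp E).continuous.comp_continuousOn hsol.continuousOn_deriv
  have key : ∀ x ∈ Icc 0 L, past T (R (E (vx x))) = past T (R (E (vx 0))) +
      κ⁻¹ • past T (∫ t in (0 : ℝ)..x, (E (v t) - R (E (v t)))) := by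
    intro x hx
    -- Pairing with each test function ψ before time T reduces the vector identity to the scalar
    -- one.
    have h1 : past T (κ • (R (E (vx x)) - R (E (vx 0))) -
        ∫ t in (0 : ℝ)..x, (E (v t) - R (E (v t)))) = 0 := by
      refine past_eq_zero_of_inner fun ψ h1 h2 h3 => ?_
      set p : TimeL2 := toL2 fun t => (ψ t : ℂ)
      have h4 := deriv_eq_integral_of_weak (κ := κ) hL
        (a := fun x => inner ℂ p (E (v x) - R (E (v x)))) (b := fun x => inner ℂ p (R (E (v x))))
        (b' := fun x => inner ℂ p (R (E (vx x))))
        ((innerSL ℂ p).continuous.comp_continuousOn hQ)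
        ((innerSL ℂ p).continuous.comp_continuousOn hRx)
        (fun y hy => (((innerSL ℂ p).comp (R.comp E)).restrictScalars ℝ).hasFDerivAt.comp_hasDerivWithinAt
          y (hsol.hasDeriv y hy))
        (fun η e1 e2 e3 => hsol.integral_inner_eq_zero hT h1 h2 h3 e1 e2 e3) x hx
      have h5 : IntervalIntegrable (fun x => E (v x) - R (E (v x))) volume 0 x :=
        (hQ.mono (Icc_subset_Icc_right hx.2)).intervalIntegrable_of_Icc hx.1
      have h6 : ∫ t in (0 : ℝ)..x, inner ℂ p (E (v t) - R (E (v t))) =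
          inner ℂ p (∫ t in (0 : ℝ)..x, (E (v t) - R (E (v t)))) :=
        (innerSL ℂ p).intervalIntegral_comp_comm h5
      rw [inner_sub_right, inner_smul_right, inner_sub_right, h4, h6, sub_self]
    rw [map_sub, map_smul, map_sub, sub_eq_zero] at h1
    rw [← h1, inv_smul_smul₀ hκ]
    abel
  intro x hx
  have h2 := ((((past T).restrictScalars ℝ).hasFDerivAt.comp_hasDerivWithinAt x
    (hasDerivWithinAt_integral_Icc hL.le hQ x hx)).const_smul κ⁻¹).const_add
      (past T (R (E (vx 0))))
  exact h2.congr key (key x hx)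

lemma past_extendTime (T : ℝ) (u : TimeL2On T) : past T (extendTime T u) = extendTime T u := by
  apply Lp.ext
  filter_upwards [coeFn_past T (extendTime T u), coeFn_extendTime T u] with t h1 h2
  rw [h1]
  by_cases ht : t ∈ Iio T
  · simp [ht]
  · rw [indicator_of_notMem ht, h2, indicator_of_notMem fun h => ht h.2]

/-- The difference, extended by zero in time, satisfies the hypotheses of the energy argument for
times before T, with zero boundary data. -/
theorem IsReducedSolution.unique {ν α L T : ℝ} (hν : 0 < ν) (hL : 0 < L) (hT : 0 < T)
    {g h : TimeL2} {v vx v' vx' : ℝ → TimeL2On T} (h1 : IsReducedSolution ν α L T g h v vx)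
    (h2 : IsReducedSolution ν α L T g h v' vx') : EqOn v v' (Icc 0 L) := by
  have hE : ∀ x ∈ Icc 0 L, past T (extendTime T (v x - v' x)) = 0 := by
    refine past_eq_zero_of_resolvent_equation (norm_past_le T) norm_cayley_le (past_past T)
      (past_timeResolvent T) (κ := (ν : ℂ) + Complex.I * α) (by simpa using hν) hL
      (V' := fun x => extendTime T (vx x - vx' x)) (fun x hx => ?_) (fun x hx => ?_) ?_ ?_
    · exact ((extendTime T).restrictScalars ℝ).hasFDerivAt.comp_hasDerivWithinAt x
        ((h1.hasDeriv x hx).sub (h2.hasDeriv x hx))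
    · have := (h1.resolvent_equation hν hL hT x hx).sub (h2.resolvent_equation hν hL hT x hx)
      convert! this using 1
      · ext1 y
        simp
      · simp only [map_sub, smul_sub]
        abel
    · have : v 0 = v' 0 := Lp.ext (EventuallyEq.trans h1.dirichlet (EventuallyEq.symm h2.dirichlet))
      simp [this]
    · have : vx L = vx' L := Lp.ext (EventuallyEq.trans h1.neumann (EventuallyEq.symm h2.neumann))
      simp [this]
  intro x hx
  have h3 := hE x hx
  rw [past_extendTime] at h3
  exact sub_eq_zero.1 (extendTime_injective T (h3.trans (map_zero _).symm))

/-! ### Hyperbolic functions in a sector and the bounds for the multipliers -/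

lemma normSq_cosh (z : ℂ) :
    Complex.normSq (Complex.cosh z) = Real.cosh z.re ^ 2 - Real.sin z.im ^ 2 := by
  conv_lhs => rw [← Complex.re_add_im z]
  rw [Complex.cosh_add, Complex.cosh_mul_I, Complex.sinh_mul_I, ← Complex.ofReal_cosh,
    ← Complex.ofReal_sinh, ← Complex.ofReal_cos, ← Complex.ofReal_sin, Complex.normSq_apply]
  simp only [Complex.add_re, Complex.add_im, Complex.mul_re, Complex.mul_im, Complex.ofReal_re,
    Complex.ofReal_im, Complex.I_re, Complex.I_im]
  linear_combination Real.cosh z.re ^ 2 * Real.sin_sq_add_cos_sq z.im -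
    Real.sin z.im ^ 2 * Real.cosh_sq z.re

lemma normSq_sinh (z : ℂ) :
    Complex.normSq (Complex.sinh z) = Real.cosh z.re ^ 2 - Real.cos z.im ^ 2 := by
  conv_lhs => rw [← Complex.re_add_im z]
  rw [Complex.sinh_add, Complex.cosh_mul_I, Complex.sinh_mul_I, ← Complex.ofReal_cosh,
    ← Complex.ofReal_sinh, ← Complex.ofReal_cos, ← Complex.ofReal_sin, Complex.normSq_apply]
  simp only [Complex.add_re, Complex.add_im, Complex.mul_re, Complex.mul_im, Complex.ofReal_re,
    Complex.ofReal_im, Complex.I_re, Complex.I_im]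
  linear_combination Real.cosh z.re ^ 2 * Real.sin_sq_add_cos_sq z.im -
    Real.cos z.im ^ 2 * Real.cosh_sq z.re

lemma norm_cosh_le (z : ℂ) : ‖Complex.cosh z‖ ≤ Real.cosh z.re := by
  rw [Complex.norm_def, normSq_cosh]
  exact Real.sqrt_le_iff.2 ⟨(Real.cosh_pos _).le, by nlinarith [sq_nonneg (Real.sin z.im)]⟩

lemma norm_sinh_le (z : ℂ) : ‖Complex.sinh z‖ ≤ Real.cosh z.re := by
  rw [Complex.norm_def, normSq_sinh]
  exact Real.sqrt_le_iff.2 ⟨(Real.cosh_pos _).le, by nlinarith [sq_nonneg (Real.cos z.im)]⟩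

/-- In a sector around the positive half-line, `cosh` is bounded below by its size there. -/
lemma exists_cosh_le_norm_cosh {M : ℝ} (hM : 0 < M) :
    ∃ c : ℝ, 0 < c ∧ ∀ z : ℂ, |z.im| ≤ M * z.re → Real.cosh z.re ≤ c * ‖Complex.cosh z‖ := by
  set C := Real.cosh M⁻¹ with hCdef
  have hC : 1 < C := Real.one_lt_cosh.2 (by positivity)
  have hd : 0 < 1 - (C ^ 2)⁻¹ := by
    have : (C ^ 2)⁻¹ < 1 := inv_lt_one_of_one_lt₀ (by nlinarith)
    linarith
  -- Two regimes for |cosh z|² = cosh²(Re z) - sin²(Im z). If |Im z| ≤ 1, then cos²(Im z) ≥ 1/4 and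
  -- cosh ≥ 1 give the factor 1/4. Otherwise the sector forces Re z ≥ M⁻¹, and cosh² - 1 ≥ (1 - C⁻²)
  -- cosh².
  set d := min (1 / 4) (1 - (C ^ 2)⁻¹) with hddef
  have hd0 : 0 < d := lt_min (by norm_num) hd
  refine ⟨(Real.sqrt d)⁻¹, by positivity, fun z hz => ?_⟩
  have hcosh := Real.one_le_cosh z.re
  have key : d * Real.cosh z.re ^ 2 ≤ Complex.normSq (Complex.cosh z) := by
    rw [normSq_cosh]
    rcases le_or_gt |z.im| 1 with h | h
    · have h1 := Real.one_sub_sq_div_two_le_cos (x := z.im)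
      have h2 : z.im ^ 2 ≤ 1 := by
        rw [← sq_abs]
        nlinarith [abs_nonneg z.im]
      have h3 : 1 / 4 ≤ Real.cos z.im ^ 2 := by nlinarith
      have h4 : d ≤ 1 / 4 := min_le_left _ _
      nlinarith [Real.sin_sq_add_cos_sq z.im, sq_nonneg (Real.sin z.im),
        mul_le_mul_of_nonneg_right h4 (sq_nonneg (Real.cosh z.re)),
        mul_nonneg (sq_nonneg (Real.sin z.im)) (show 0 ≤ Real.cosh z.re ^ 2 - 1 by nlinarith)]
    · have h1 : M⁻¹ ≤ z.re := by
        rw [inv_le_iff_one_le_mul₀ hM]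
        linarith
      have h2 : C ≤ Real.cosh z.re := by
        rw [hCdef, Real.cosh_le_cosh, abs_of_pos (by positivity)]
        exact h1.trans (le_abs_self _)
      have h4 : d ≤ 1 - (C ^ 2)⁻¹ := min_le_right _ _
      have h5 : 1 ≤ (C ^ 2)⁻¹ * Real.cosh z.re ^ 2 := by
        rw [inv_mul_eq_div, one_le_div (by positivity)]
        gcongr
      nlinarith [Real.sin_sq_le_one z.im,
        mul_le_mul_of_nonneg_right h4 (sq_nonneg (Real.cosh z.re))]
  rw [le_inv_mul_iff₀ (by positivity), Complex.norm_def]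
  refine Real.le_sqrt_of_sq_le ?_
  rw [mul_pow, Real.sq_sqrt hd0.le]
  exact key

/-- The root `λ` of `κ λ² = i τ`, `τ = 2 π ξ`, in the right half-plane. -/
def waveNumber (κ : ℂ) (ξ : ℝ) : ℂ := (2 * Real.pi * Complex.I * ξ / κ) ^ (2⁻¹ : ℂ)

lemma measurable_waveNumber (κ : ℂ) : Measurable (waveNumber κ) := by
  unfold waveNumber
  fun_prop

lemma waveNumber_sq (κ : ℂ) (ξ : ℝ) : waveNumber κ ξ ^ 2 = 2 * Real.pi * Complex.I * ξ / κ :=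
  Complex.cpow_ofNat_inv_pow _ _

lemma waveNumber_re_nonneg (κ : ℂ) (ξ : ℝ) : 0 ≤ (waveNumber κ ξ).re := by
  rw [waveNumber, Complex.cpow_inv_two_re]
  positivity

lemma waveNumber_ne_zero {κ : ℂ} (hκ : κ ≠ 0) {ξ : ℝ} (hξ : ξ ≠ 0) : waveNumber κ ξ ≠ 0 := by
  intro h
  have := waveNumber_sq κ ξ
  rw [h, zero_pow two_ne_zero, eq_comm] at this
  simp [hκ, hξ, Real.pi_ne_zero] at this

lemma norm_waveNumber_sq (κ : ℂ) (ξ : ℝ) : ‖waveNumber κ ξ‖ ^ 2 = |2 * Real.pi * ξ| / ‖κ‖ := by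
  rw [← norm_pow, waveNumber_sq]
  simp [abs_mul]

/-- Since κλ² is imaginary, λ = a + ib satisfies Re κ (a² - b²) = 2 Im κ ab, so b² ≤ a² + 2qa|b|
with q = |Im κ|/Re κ. Where |b| > a, this is at most (1 + 2q)a|b|, and |b| cancels. -/
lemma abs_waveNumber_im_le {κ : ℂ} (hκ : 0 < κ.re) (ξ : ℝ) :
    |(waveNumber κ ξ).im| ≤ (2 * (|κ.im| / κ.re) + 1) * (waveNumber κ ξ).re := by
  have hκ0 : κ ≠ 0 := fun h => by simp [h] at hκ
  have h1 : κ * waveNumber κ ξ ^ 2 = 2 * Real.pi * Complex.I * ξ := by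
    rw [waveNumber_sq]
    field_simp
  have ha := waveNumber_re_nonneg κ ξ
  set a := (waveNumber κ ξ).re with hadef
  set b := (waveNumber κ ξ).im with hbdef
  have h2 : κ.re * (a ^ 2 - b ^ 2) = κ.im * (2 * a * b) := by
    have := congrArg Complex.re h1
    simp [pow_two] at this
    rw [← hadef, ← hbdef] at this
    linarith
  set q := |κ.im| / κ.re with hq
  have hq0 : 0 ≤ q := by positivity
  have h3 : b ^ 2 ≤ a ^ 2 + 2 * q * (a * |b|) := by
    have h4 : κ.re * (b ^ 2 - a ^ 2) ≤ κ.re * (2 * q * (a * |b|)) := by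
      have h5 : κ.re * q = |κ.im| := by
        rw [hq]
        field_simp
      calc κ.re * (b ^ 2 - a ^ 2) = -(κ.im * (2 * a * b)) := by linarith
        _ ≤ |κ.im * (2 * a * b)| := neg_le_abs _
        _ = (κ.re * q) * (2 * (a * |b|)) := by
          rw [h5, abs_mul, abs_mul, abs_mul, abs_of_nonneg ha, abs_two]
          ring
        _ = _ := by ring
    have := le_of_mul_le_mul_left h4 hκ
    linarith
  rcases le_or_gt |b| a with h | h
  · nlinarith [mul_nonneg hq0 ha]
  · have hb : 0 < |b| := ha.trans_lt h
    have h6 : |b| * |b| ≤ ((2 * q + 1) * a) * |b| := by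
      rw [← sq_abs b] at h3
      nlinarith
    exact le_of_mul_le_mul_right h6 hb

/-- The Fourier multipliers that carry the boundary values to the solution and its derivative. -/
def dirichletSymbol (κ : ℂ) (L x ξ : ℝ) : ℂ :=
  Complex.cosh (waveNumber κ ξ * (L - x)) / Complex.cosh (waveNumber κ ξ * L)

/-- The `x`-derivative of `dirichletSymbol`. -/
def dirichletSymbolDeriv (κ : ℂ) (L x ξ : ℝ) : ℂ :=
  -(waveNumber κ ξ * Complex.sinh (waveNumber κ ξ * (L - x))) / Complex.cosh (waveNumber κ ξ * L)

/-- The Fourier multiplier that carries the Neumann datum to the solution. -/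
def neumannSymbol (κ : ℂ) (L x ξ : ℝ) : ℂ :=
  Complex.sinh (waveNumber κ ξ * x) / (waveNumber κ ξ * Complex.cosh (waveNumber κ ξ * L))

/-- The `x`-derivative of `neumannSymbol`. -/
def neumannSymbolDeriv (κ : ℂ) (L x ξ : ℝ) : ℂ :=
  Complex.cosh (waveNumber κ ξ * x) / Complex.cosh (waveNumber κ ξ * L)

section Symbols

variable {κ : ℂ} {L : ℝ}

lemma measurable_dirichletSymbol (x : ℝ) : Measurable (dirichletSymbol κ L x) := by
  have := measurable_waveNumber κ
  unfold dirichletSymbol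
  fun_prop

lemma measurable_dirichletSymbolDeriv (x : ℝ) : Measurable (dirichletSymbolDeriv κ L x) := by
  have := measurable_waveNumber κ
  unfold dirichletSymbolDeriv
  fun_prop

lemma measurable_neumannSymbol (x : ℝ) : Measurable (neumannSymbol κ L x) := by
  have := measurable_waveNumber κ
  unfold neumannSymbol
  fun_prop

lemma measurable_neumannSymbolDeriv (x : ℝ) : Measurable (neumannSymbolDeriv κ L x) := by
  have := measurable_waveNumber κ
  unfold neumannSymbolDeriv
  fun_prop

lemma hasDerivAt_dirichletSymbol (ξ x : ℝ) :
    HasDerivAt (fun y => dirichletSymbol κ L y ξ) (dirichletSymbolDeriv κ L x ξ) x := by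
  have h : HasDerivAt (fun y : ℝ => waveNumber κ ξ * ((L : ℂ) - y)) (waveNumber κ ξ * -1) x :=
    ((Complex.ofRealCLM.hasDerivAt (x := x)).const_sub (L : ℂ)).const_mul (waveNumber κ ξ)
  refine (((Complex.hasDerivAt_cosh _).comp x h).div_const _).congr_deriv ?_
  rw [dirichletSymbolDeriv]
  ring

lemma hasDerivAt_dirichletSymbolDeriv (ξ x : ℝ) :
    HasDerivAt (fun y => dirichletSymbolDeriv κ L y ξ)
      (waveNumber κ ξ ^ 2 * dirichletSymbol κ L x ξ) x := by
  have h : HasDerivAt (fun y : ℝ => waveNumber κ ξ * ((L : ℂ) - y)) (waveNumber κ ξ * -1) x :=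
    ((Complex.ofRealCLM.hasDerivAt (x := x)).const_sub (L : ℂ)).const_mul (waveNumber κ ξ)
  refine ((((Complex.hasDerivAt_sinh _).comp x h).const_mul (waveNumber κ ξ)).fun_neg.div_const _).congr_deriv ?_
  rw [dirichletSymbol]
  ring

/-- At λ = 0 the quotient takes the default value 0 for every x, although its formal derivative is
1; that frequency is excluded, and it is negligible. -/
lemma hasDerivAt_neumannSymbol (ξ x : ℝ) (hξ : waveNumber κ ξ ≠ 0) :
    HasDerivAt (fun y => neumannSymbol κ L y ξ) (neumannSymbolDeriv κ L x ξ) x := by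
  have h : HasDerivAt (fun y : ℝ => waveNumber κ ξ * (y : ℂ)) (waveNumber κ ξ * 1) x :=
    (Complex.ofRealCLM.hasDerivAt (x := x)).const_mul (waveNumber κ ξ)
  refine (((Complex.hasDerivAt_sinh _).comp x h).div_const _).congr_deriv ?_
  rw [neumannSymbolDeriv, mul_one, mul_comm (Complex.cosh _), mul_div_mul_left _ _ hξ]

lemma hasDerivAt_neumannSymbolDeriv (ξ x : ℝ) (hξ : waveNumber κ ξ ≠ 0) :
    HasDerivAt (fun y => neumannSymbolDeriv κ L y ξ)
      (waveNumber κ ξ ^ 2 * neumannSymbol κ L x ξ) x := by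
  have h : HasDerivAt (fun y : ℝ => waveNumber κ ξ * (y : ℂ)) (waveNumber κ ξ * 1) x :=
    (Complex.ofRealCLM.hasDerivAt (x := x)).const_mul (waveNumber κ ξ)
  refine (((Complex.hasDerivAt_cosh _).comp x h).div_const _).congr_deriv ?_
  rw [neumannSymbol]
  field_simp

/-- The weight `(1 + τ²)^{1/4}`. -/
def quarterWeight (ξ : ℝ) : ℝ := (1 + (2 * Real.pi * ξ) ^ 2) ^ (1 / 4 : ℝ)

lemma one_le_quarterWeight (ξ : ℝ) : 1 ≤ quarterWeight ξ :=
  Real.one_le_rpow (by nlinarith [sq_nonneg (2 * Real.pi * ξ)]) (by norm_num)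

lemma measurable_quarterWeight : Measurable quarterWeight := by
  unfold quarterWeight
  fun_prop

lemma quarterWeight_sq (ξ : ℝ) :
    quarterWeight ξ ^ 2 = (1 + (2 * Real.pi * ξ) ^ 2) ^ (1 / 2 : ℝ) := by
  rw [quarterWeight, ← Real.rpow_natCast, ← Real.rpow_mul (by positivity)]
  norm_num

lemma quarterWeight_sq_le (ξ : ℝ) : quarterWeight ξ ^ 2 ≤ 1 + |2 * Real.pi * ξ| := by
  rw [quarterWeight_sq, ← Real.sqrt_eq_rpow]
  refine Real.sqrt_le_iff.2 ⟨by positivity, ?_⟩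
  nlinarith [sq_abs (2 * Real.pi * ξ), abs_nonneg (2 * Real.pi * ξ)]

lemma abs_le_quarterWeight_sq (ξ : ℝ) : |2 * Real.pi * ξ| ≤ quarterWeight ξ ^ 2 := by
  rw [quarterWeight_sq, ← Real.sqrt_eq_rpow]
  refine Real.le_sqrt_of_sq_le ?_
  rw [sq_abs]
  linarith

/-- Uniform bounds for the four multipliers. -/
lemma exists_symbol_bound (hκ : 0 < κ.re) (hL : 0 < L) :
    ∃ K : ℝ, 0 < K ∧ ∀ ξ : ℝ, ξ ≠ 0 → Complex.cosh (waveNumber κ ξ * L) ≠ 0 ∧ ∀ x ∈ Icc 0 L,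
      ‖dirichletSymbol κ L x ξ‖ ≤ K ∧
      ‖dirichletSymbolDeriv κ L x ξ‖ ≤ K * quarterWeight ξ ∧
      ‖neumannSymbol κ L x ξ‖ ≤ K / quarterWeight ξ ∧
      ‖neumannSymbolDeriv κ L x ξ‖ ≤ K := by
  have hκ0 : κ ≠ 0 := fun h => by simp [h] at hκ
  have hn : 0 < ‖κ‖ := norm_pos_iff.2 hκ0
  set s := Real.sqrt ‖κ‖ with hs
  have hs0 : 0 < s := Real.sqrt_pos.2 hn
  have hs2 : s ^ 2 = ‖κ‖ := Real.sq_sqrt hn.le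
  obtain ⟨c, hc, hcosh⟩ := exists_cosh_le_norm_cosh
    (M := 2 * (|κ.im| / κ.re) + 1) (by positivity)
  -- The summand 1 covers the multipliers of order zero, s⁻¹ comes from |λ| ≤ s⁻¹J, and L + s from
  -- the Neumann multiplier at low and high frequency.
  refine ⟨c * (1 + s⁻¹ + L + s), by positivity, fun ξ hξ => ?_⟩
  have hl := waveNumber_ne_zero hκ0 hξ
  have ha := waveNumber_re_nonneg κ ξ
  have him := abs_waveNumber_im_le hκ ξ
  have hnorm := norm_waveNumber_sq κ ξ
  set l := waveNumber κ ξ with hldef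
  have hJ1 := one_le_quarterWeight ξ
  have hJ2 := quarterWeight_sq_le ξ
  have hJ3 := abs_le_quarterWeight_sq ξ
  set J := quarterWeight ξ with hJdef
  have hre : ∀ y : ℝ, (l * y).re = l.re * y := fun y => by simp
  have hden : Real.cosh (l.re * L) ≤ c * ‖Complex.cosh (l * L)‖ := by
    rw [← hre]
    refine hcosh _ ?_
    have e : (l * (L : ℂ)).im = l.im * L := by simp
    rw [e, hre, abs_mul, abs_of_pos hL, ← mul_assoc]
    gcongr
  have hpos : 0 < ‖Complex.cosh (l * L)‖ := by
    have := Real.cosh_pos (l.re * L)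
    by_contra h
    have h' : ‖Complex.cosh (l * L)‖ = 0 := le_antisymm (not_lt.1 h) (norm_nonneg _)
    rw [h', mul_zero] at hden
    linarith
  have hnum : ∀ y ∈ Icc 0 L, Real.cosh ((l * (y : ℂ)).re) ≤ c * ‖Complex.cosh (l * L)‖ := by
    intro y hy
    refine le_trans ?_ hden
    rw [hre, Real.cosh_le_cosh, abs_of_nonneg (mul_nonneg ha hy.1),
      abs_of_nonneg (mul_nonneg ha hL.le)]
    exact mul_le_mul_of_nonneg_left hy.2 ha
  have hcc : ∀ y ∈ Icc 0 L, ‖Complex.cosh (l * (y : ℂ)) / Complex.cosh (l * L)‖ ≤ c := by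
    intro y hy
    rw [norm_div, div_le_iff₀ hpos]
    exact (norm_cosh_le _).trans (hnum y hy)
  have hsc : ∀ y ∈ Icc 0 L, ‖Complex.sinh (l * (y : ℂ)) / Complex.cosh (l * L)‖ ≤ c := by
    intro y hy
    rw [norm_div, div_le_iff₀ hpos]
    exact (norm_sinh_le _).trans (hnum y hy)
  have hlJ : ‖l‖ ≤ s⁻¹ * J := by
    refine abs_le_of_sq_le_sq' ?_ (by positivity) |>.2
    rw [hnorm, mul_pow, inv_pow, hs2, div_eq_inv_mul]
    gcongr
  have hcK : c ≤ c * (1 + s⁻¹ + L + s) := by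
    have : 0 ≤ c * (s⁻¹ + L + s) := by positivity
    linarith
  refine ⟨norm_pos_iff.1 hpos, fun x hx => ?_⟩
  have hx' : L - x ∈ Icc 0 L := ⟨by linarith [hx.2], by linarith [hx.1]⟩
  refine ⟨?_, ?_, ?_, (hcc x hx).trans hcK⟩
  · have := hcc _ hx'
    push_cast at this
    exact this.trans hcK
  · have := hsc _ hx'
    push_cast at this
    rw [dirichletSymbolDeriv, ← hldef, neg_div, norm_neg, mul_div_assoc, norm_mul]
    calc _ ≤ (s⁻¹ * J) * c := by gcongr
      _ ≤ _ := by
        have : 0 ≤ c * (1 + L + s) * J := by positivity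
        nlinarith
  -- The bound |λ|B ≤ c degenerates at low frequency, where B ≤ cL takes over by integration from x
  -- = 0. They combine through J² ≤ 1 + |τ| = 1 + s²|λ|².
  · have hB1 : ‖l‖ * ‖neumannSymbol κ L x ξ‖ ≤ c := by
      have e : l * neumannSymbol κ L x ξ = Complex.sinh (l * x) / Complex.cosh (l * L) := by
        rw [neumannSymbol, ← hldef]
        field_simp
      rw [← norm_mul, e]
      exact hsc x hx
    have hB2 : ‖neumannSymbol κ L x ξ‖ ≤ c * L := by
      have h0 : neumannSymbol κ L 0 ξ = 0 := by simp [neumannSymbol]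
      have := (convex_Icc 0 L).norm_image_sub_le_of_norm_hasDerivWithin_le (C := c)
        (f := fun y => neumannSymbol κ L y ξ) (f' := fun y => neumannSymbolDeriv κ L y ξ)
        (fun y _ => (hasDerivAt_neumannSymbol ξ y hl).hasDerivWithinAt) (fun y hy => hcc y hy)
        ⟨le_rfl, hL.le⟩ hx
      simp only [h0, sub_zero] at this
      refine this.trans ?_
      rw [Real.norm_of_nonneg hx.1]
      exact mul_le_mul_of_nonneg_left hx.2 hc.le
    rw [le_div_iff₀ (by positivity)]
    set B := ‖neumannSymbol κ L x ξ‖ with hBdef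
    have hB0 : 0 ≤ B := norm_nonneg _
    have h5 : (B * J) ^ 2 ≤ (c * (L + s)) ^ 2 := by
      have h6 : |2 * Real.pi * ξ| = s ^ 2 * ‖l‖ ^ 2 := by
        rw [hnorm, hs2]
        field_simp
      have h7 : B ^ 2 * J ^ 2 ≤ B ^ 2 * (1 + s ^ 2 * ‖l‖ ^ 2) := by
        rw [← h6]
        gcongr
      have h8 : B ^ 2 ≤ (c * L) ^ 2 := by gcongr
      have h9 : (‖l‖ * B) ^ 2 ≤ c ^ 2 := by gcongr
      have h10 : 0 ≤ c ^ 2 * (L * s) := by positivity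
      nlinarith [mul_le_mul_of_nonneg_left h9 (sq_nonneg s)]
    have h11 := abs_le_of_sq_le_sq' h5 (by positivity) |>.2
    have h12 : 0 ≤ c * (1 + s⁻¹) := by positivity
    linarith

end Symbols

end

/-! ### The solution on the whole time line -/

section

open scoped SchwartzMap ComplexConjugate

lemma sobolevNorm_sq (m : ℝ) (u : TimeL2) : sobolevNorm m u ^ 2 =
    ∫⁻ ξ : ℝ, ENNReal.ofReal ((1 + (2 * Real.pi * ξ) ^ 2) ^ m) * ‖(𝓕 u : TimeL2) ξ‖ₑ ^ 2 := by
  rw [sobolevNorm, ← ENNReal.rpow_natCast, ← ENNReal.rpow_mul]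
  norm_num

lemma coeFn_fourier_fourierInv {f : ℝ → ℂ} (hf : MemLp f 2 (volume : Measure ℝ)) :
    (𝓕 (𝓕⁻ (toL2 f) : TimeL2) : TimeL2) =ᵐ[volume] f := by
  rw [FourierTransform.fourier_fourierInv_eq]
  exact coeFn_toL2 hf

lemma sobolevNorm_fourierInv {f : ℝ → ℂ} (hf : MemLp f 2 (volume : Measure ℝ)) (m : ℝ) :
    sobolevNorm m (𝓕⁻ (toL2 f) : TimeL2) =
      (∫⁻ ξ : ℝ, ENNReal.ofReal ((1 + (2 * Real.pi * ξ) ^ 2) ^ m) * ‖f ξ‖ₑ ^ 2) ^ (1 / 2 : ℝ) := by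
  rw [sobolevNorm]
  congr 1
  refine lintegral_congr_ae ?_
  filter_upwards [coeFn_fourier_fourierInv hf] with ξ h
  rw [h]

lemma fourierInv_sub (u v : TimeL2) : (𝓕⁻ (u - v) : TimeL2) = 𝓕⁻ u - 𝓕⁻ v :=
  map_sub (Lp.fourierTransformₗᵢ ℝ ℂ).symm u v

lemma sobolevNorm_fourierInv_le {f : ℝ → ℂ} {b : ℝ → ℝ} (hf : MemLp f 2 (volume : Measure ℝ))
    (hb : ∀ᵐ ξ, ‖f ξ‖ ≤ b ξ) (m : ℝ) :
    sobolevNorm m (𝓕⁻ (toL2 f) : TimeL2) ≤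
      (∫⁻ ξ : ℝ, ENNReal.ofReal ((1 + (2 * Real.pi * ξ) ^ 2) ^ m) *
        ENNReal.ofReal (b ξ) ^ 2) ^ (1 / 2 : ℝ) := by
  rw [sobolevNorm_fourierInv hf]
  refine ENNReal.rpow_le_rpow (lintegral_mono_ae ?_) (by norm_num)
  filter_upwards [hb] with ξ h
  gcongr
  rw [← ofReal_norm]
  exact ENNReal.ofReal_le_ofReal h

lemma tendsto_sobolevNorm_fourierInv_sub {f : ℝ → ℝ → ℂ} {b : ℝ → ℝ} {m L : ℝ}
    (hf : ∀ x ∈ Icc 0 L, MemLp (f x) 2 (volume : Measure ℝ))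
    (hb : ∀ᵐ ξ, ∀ x ∈ Icc 0 L, ‖f x ξ‖ ≤ b ξ)
    (hc : ∀ᵐ ξ, ∀ x ∈ Icc 0 L, ContinuousWithinAt (fun y => f y ξ) (Icc 0 L) x)
    (hfin : ∫⁻ ξ : ℝ, ENNReal.ofReal ((1 + (2 * Real.pi * ξ) ^ 2) ^ m) *
        ENNReal.ofReal (b ξ) ^ 2 ≠ ∞) {x : ℝ} (hx : x ∈ Icc 0 L) :
    Tendsto (fun y => sobolevNorm m ((𝓕⁻ (toL2 (f y)) : TimeL2) - (𝓕⁻ (toL2 (f x)) : TimeL2)))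
      (𝓝[Icc 0 L] x) (𝓝 0) := by
  have hmem : ∀ᶠ y in 𝓝[Icc 0 L] x, y ∈ Icc 0 L := self_mem_nhdsWithin
  have key := tendsto_lintegral_mul_enorm_sq (l := 𝓝[Icc 0 L] x)
    (w := fun ξ => ENNReal.ofReal ((1 + (2 * Real.pi * ξ) ^ 2) ^ m))
    (F := fun y ξ => f y ξ - f x ξ) (b := fun ξ => 2 * b ξ) (by fun_prop) (by simp)
    (hmem.mono fun y hy => (hf y hy).1.sub (hf x hx).1) ?_ ?_ ?_
  · have h2 := (ENNReal.continuous_rpow_const (y := (1 / 2 : ℝ))).tendsto 0 |>.comp key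
    rw [ENNReal.zero_rpow_of_pos (by norm_num)] at h2
    refine h2.congr' ?_
    filter_upwards [hmem] with y hy
    rw [← fourierInv_sub, ← toL2_sub (hf y hy) (hf x hx),
      sobolevNorm_fourierInv (f := fun ξ => f y ξ - f x ξ) ((hf y hy).sub (hf x hx))]
    rfl
  · filter_upwards [hmem] with y hy
    filter_upwards [hb] with ξ h
    linarith [norm_sub_le (f y ξ) (f x ξ), h y hy, h x hx]
  · have : ∀ ξ, ENNReal.ofReal ((1 + (2 * Real.pi * ξ) ^ 2) ^ m) *
        ENNReal.ofReal (2 * b ξ) ^ 2 = 4 * (ENNReal.ofReal ((1 + (2 * Real.pi * ξ) ^ 2) ^ m) *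
        ENNReal.ofReal (b ξ) ^ 2) := fun ξ => by
      rw [ENNReal.ofReal_mul (by norm_num), ENNReal.ofReal_ofNat]
      ring
    simp only [this]
    rw [lintegral_const_mul' _ _ (by norm_num)]
    exact ENNReal.mul_ne_top (by norm_num) hfin
  · filter_upwards [hc] with ξ h
    have : Tendsto (fun y => f y ξ) (𝓝[Icc 0 L] x) (𝓝 (f x ξ)) := h x hx
    simpa using this.sub_const (f x ξ)

lemma memLp_two_of_lintegral {b : ℝ → ℝ} (hb : Measurable b) {m : ℝ} (hm : 0 ≤ m)
    (hb0 : ∀ ξ, 0 ≤ b ξ)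
    (hfin : ∫⁻ ξ : ℝ, ENNReal.ofReal ((1 + (2 * Real.pi * ξ) ^ 2) ^ m) *
        ENNReal.ofReal (b ξ) ^ 2 ≠ ∞) : MemLp b 2 (volume : Measure ℝ) := by
  refine ⟨hb.aestronglyMeasurable, ?_⟩
  rw [eLpNorm_eq_lintegral_rpow_enorm_toReal (by norm_num) (by norm_num)]
  refine ENNReal.rpow_lt_top_of_nonneg (by norm_num) (ne_top_of_le_ne_top hfin ?_)
  refine lintegral_mono fun ξ => ?_
  simp only [ENNReal.toReal_ofNat, ENNReal.rpow_ofNat]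
  rw [Real.enorm_of_nonneg (hb0 ξ)]
  refine le_mul_of_one_le_left zero_le ?_
  rw [ENNReal.one_le_ofReal]
  exact Real.one_le_rpow (by nlinarith [sq_nonneg (2 * Real.pi * ξ)]) hm

lemma weight_succ (s ξ : ℝ) : (1 + (2 * Real.pi * ξ) ^ 2) ^ ((2 * s + 1) / 4) =
    (1 + (2 * Real.pi * ξ) ^ 2) ^ ((2 * s - 1) / 4) * quarterWeight ξ ^ 2 := by
  rw [quarterWeight_sq, ← Real.rpow_add (by positivity)]
  congr 1
  ring

/-- The pointwise bound for the transform of the derivative of the solution. -/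
def symbolBound (K : ℝ) (g h : TimeL2) (ξ : ℝ) : ℝ :=
  K * (quarterWeight ξ * ‖(𝓕 g : TimeL2) ξ‖ + ‖(𝓕 h : TimeL2) ξ‖)

lemma symbolBound_nonneg {K : ℝ} (hK : 0 ≤ K) (g h : TimeL2) (ξ : ℝ) : 0 ≤ symbolBound K g h ξ := by
  have := one_le_quarterWeight ξ
  unfold symbolBound
  positivity

lemma measurable_symbolBound (K : ℝ) (g h : TimeL2) : Measurable (symbolBound K g h) := by
  have h1 := measurable_quarterWeight
  have h2 : Measurable (𝓕 g : TimeL2) := (Lp.stronglyMeasurable _).measurable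
  have h3 : Measurable (𝓕 h : TimeL2) := (Lp.stronglyMeasurable _).measurable
  unfold symbolBound
  fun_prop

/-- From (Ja + b)² ≤ 2(J²a² + b²), where J² raises the Sobolev weight from exponent (2s - 1)/4 to
(2s + 1)/4. -/
lemma lintegral_symbolBound_le {K : ℝ} (hK : 0 ≤ K) (s : ℝ) (g h : TimeL2) :
    ∫⁻ ξ : ℝ, ENNReal.ofReal ((1 + (2 * Real.pi * ξ) ^ 2) ^ ((2 * s - 1) / 4)) *
        ENNReal.ofReal (symbolBound K g h ξ) ^ 2 ≤
      (ENNReal.ofReal (2 * K) *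
        (sobolevNorm ((2 * s + 1) / 4) g + sobolevNorm ((2 * s - 1) / 4) h)) ^ 2 := by
  set a := sobolevNorm ((2 * s + 1) / 4) g with ha
  set b := sobolevNorm ((2 * s - 1) / 4) h with hb
  have h1 : ∫⁻ ξ : ℝ, ENNReal.ofReal ((1 + (2 * Real.pi * ξ) ^ 2) ^ ((2 * s - 1) / 4)) *
        ENNReal.ofReal (symbolBound K g h ξ) ^ 2 ≤ ENNReal.ofReal (2 * K ^ 2) * (a ^ 2 + b ^ 2) := by
    rw [ha, hb, sobolevNorm_sq, sobolevNorm_sq, ← lintegral_add_right _ (by fun_prop),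
      ← lintegral_const_mul' _ _ ENNReal.ofReal_ne_top]
    refine lintegral_mono fun ξ => ?_
    simp only
    have hW := weight_succ s ξ
    set W := (1 + (2 * Real.pi * ξ) ^ 2) ^ ((2 * s - 1) / 4) with hWdef
    have hW0 : 0 ≤ W := by positivity
    rw [hW, ← ofReal_norm, ← ofReal_norm, ← ENNReal.ofReal_pow (symbolBound_nonneg hK g h ξ),
      ← ENNReal.ofReal_pow (norm_nonneg _), ← ENNReal.ofReal_pow (norm_nonneg _),
      ← ENNReal.ofReal_mul hW0, ← ENNReal.ofReal_mul (by positivity),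
      ← ENNReal.ofReal_mul hW0, ← ENNReal.ofReal_add (by positivity) (by positivity),
      ← ENNReal.ofReal_mul (by positivity)]
    refine ENNReal.ofReal_le_ofReal ?_
    rw [symbolBound]
    have : 0 ≤ W * K ^ 2 := by positivity
    nlinarith [mul_nonneg this (sq_nonneg (quarterWeight ξ * ‖(𝓕 g : TimeL2) ξ‖ -
      ‖(𝓕 h : TimeL2) ξ‖))]
  refine h1.trans ?_
  rw [mul_pow, ← ENNReal.ofReal_pow (by positivity)]
  gcongr ENNReal.ofReal ?_ * ?_
  · nlinarith [sq_nonneg K]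
  · rw [add_sq, add_right_comm]
    exact le_self_add

lemma ENNReal_sqrt_le_of_le_sq {a b : ℝ≥0∞} (h : a ≤ b ^ 2) : a ^ (1 / 2 : ℝ) ≤ b := by
  refine (ENNReal.rpow_le_rpow h (by norm_num)).trans ?_
  rw [← ENNReal.rpow_natCast, ← ENNReal.rpow_mul]
  norm_num

/-- The solution has the bound of its derivative divided by J, so both estimates reduce to one
integral. -/
lemma lintegral_symbolBound_div (K s : ℝ) (g h : TimeL2) :
    ∫⁻ ξ : ℝ, ENNReal.ofReal ((1 + (2 * Real.pi * ξ) ^ 2) ^ ((2 * s + 1) / 4)) *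
        ENNReal.ofReal (symbolBound K g h ξ / quarterWeight ξ) ^ 2 =
    ∫⁻ ξ : ℝ, ENNReal.ofReal ((1 + (2 * Real.pi * ξ) ^ 2) ^ ((2 * s - 1) / 4)) *
        ENNReal.ofReal (symbolBound K g h ξ) ^ 2 := by
  refine lintegral_congr fun ξ => ?_
  have hJ : 0 < quarterWeight ξ := zero_lt_one.trans_le (one_le_quarterWeight ξ)
  rw [weight_succ, ENNReal.ofReal_mul (by positivity), ENNReal.ofReal_pow hJ.le, mul_assoc,
    ← mul_pow, ← ENNReal.ofReal_mul hJ.le, mul_div_cancel₀ _ hJ.ne']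

/-- The solution of the boundary value problem on the whole time line. -/
theorem exists_wholeLine_solution {κ : ℂ} (hκ : 0 < κ.re) {L : ℝ} (hL : 0 < L) :
    ∃ K : ℝ, 0 < K ∧ ∀ s : ℝ, 1 / 2 ≤ s → ∀ g h : TimeL2,
      sobolevNorm ((2 * s + 1) / 4) g < ∞ → sobolevNorm ((2 * s - 1) / 4) h < ∞ →
      ∃ V V' : ℝ → TimeL2,
        (∀ x ∈ Icc 0 L, HasDerivWithinAt V (V' x) (Icc 0 L) x) ∧
        ContinuousOn V' (Icc 0 L) ∧ V 0 = g ∧ V' L = h ∧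
        (∀ x ∈ Icc 0 L, HasDerivWithinAt (fun y => timeResolvent (V' y))
          (κ⁻¹ • (V x - timeResolvent (V x))) (Icc 0 L) x) ∧
        ∀ x ∈ Icc 0 L,
          sobolevNorm ((2 * s + 1) / 4) (V x) ≤ ENNReal.ofReal K *
            (sobolevNorm ((2 * s + 1) / 4) g + sobolevNorm ((2 * s - 1) / 4) h) ∧
          sobolevNorm ((2 * s - 1) / 4) (V' x) ≤ ENNReal.ofReal K *
            (sobolevNorm ((2 * s + 1) / 4) g + sobolevNorm ((2 * s - 1) / 4) h) ∧
          Tendsto (fun y => sobolevNorm ((2 * s + 1) / 4) (V y - V x)) (𝓝[Icc 0 L] x) (𝓝 0) ∧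
          Tendsto (fun y => sobolevNorm ((2 * s - 1) / 4) (V' y - V' x)) (𝓝[Icc 0 L] x) (𝓝 0) := by
  have hκ0 : κ ≠ 0 := fun h => by simp [h] at hκ
  obtain ⟨K, hK, hKb⟩ := exists_symbol_bound hκ hL
  refine ⟨2 * K, by positivity, fun s hs g h hg hh => ?_⟩
  have hne : ∀ᵐ ξ : ℝ, ξ ≠ 0 := by simp [ae_iff]
  set G : ℝ → ℂ := ⇑(𝓕 g : TimeL2) with hG
  set H : ℝ → ℂ := ⇑(𝓕 h : TimeL2) with hH
  have hGm : Measurable G := (Lp.stronglyMeasurable _).measurable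
  have hHm : Measurable H := (Lp.stronglyMeasurable _).measurable
  let f : ℝ → ℝ → ℂ := fun x ξ => dirichletSymbol κ L x ξ * G ξ + neumannSymbol κ L x ξ * H ξ
  let f' : ℝ → ℝ → ℂ := fun x ξ =>
    dirichletSymbolDeriv κ L x ξ * G ξ + neumannSymbolDeriv κ L x ξ * H ξ
  have hfm : ∀ x, Measurable (f x) := fun x =>
    ((measurable_dirichletSymbol x).mul hGm).add ((measurable_neumannSymbol x).mul hHm)
  have hf'm : ∀ x, Measurable (f' x) := fun x =>
    ((measurable_dirichletSymbolDeriv x).mul hGm).add ((measurable_neumannSymbolDeriv x).mul hHm)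
  set b := symbolBound K g h with hb
  have hJ : ∀ ξ, 0 < quarterWeight ξ := fun ξ => zero_lt_one.trans_le (one_le_quarterWeight ξ)
  have hb0 : ∀ ξ, 0 ≤ b ξ := symbolBound_nonneg hK.le g h
  have hfb : ∀ᵐ ξ, ∀ x ∈ Icc 0 L, ‖f x ξ‖ ≤ b ξ / quarterWeight ξ := by
    filter_upwards [hne] with ξ hξ x hx
    obtain ⟨h1, -, h2, -⟩ := (hKb ξ hξ).2 x hx
    have e : b ξ / quarterWeight ξ = K * ‖G ξ‖ + K / quarterWeight ξ * ‖H ξ‖ := by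
      have := (hJ ξ).ne'
      simp only [hb, symbolBound, hG, hH]
      field_simp
    rw [e]
    refine (norm_add_le _ _).trans ?_
    rw [norm_mul, norm_mul]
    gcongr
  have hf'b : ∀ᵐ ξ, ∀ x ∈ Icc 0 L, ‖f' x ξ‖ ≤ b ξ := by
    filter_upwards [hne] with ξ hξ x hx
    obtain ⟨-, h1, -, h2⟩ := (hKb ξ hξ).2 x hx
    have e : b ξ = K * quarterWeight ξ * ‖G ξ‖ + K * ‖H ξ‖ := by
      simp only [hb, symbolBound, hG, hH]
      ring
    rw [e]
    refine (norm_add_le _ _).trans ?_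
    rw [norm_mul, norm_mul]
    gcongr
  have hfb1 : ∀ᵐ ξ, ∀ x ∈ Icc 0 L, ‖f x ξ‖ ≤ b ξ := by
    filter_upwards [hfb] with ξ h1 x hx
    exact (h1 x hx).trans (div_le_self (hb0 ξ) (one_le_quarterWeight ξ))
  have hle := lintegral_symbolBound_le hK.le s g h
  have hfin : ∫⁻ ξ : ℝ, ENNReal.ofReal ((1 + (2 * Real.pi * ξ) ^ 2) ^ ((2 * s - 1) / 4)) *
        ENNReal.ofReal (b ξ) ^ 2 ≠ ∞ := by
    refine ne_top_of_le_ne_top ?_ hle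
    exact ENNReal.pow_ne_top (ENNReal.mul_ne_top ENNReal.ofReal_ne_top
      (ENNReal.add_ne_top.2 ⟨hg.ne, hh.ne⟩))
  -- This is where s ≥ 1/2 enters: the exponent (2s - 1)/4 is nonnegative, so the weighted bound
  -- controls the L² norm.
  have hb2 : MemLp b 2 (volume : Measure ℝ) :=
    memLp_two_of_lintegral (measurable_symbolBound K g h) (by linarith) hb0 hfin
  have hf2 : ∀ x ∈ Icc 0 L, MemLp (f x) 2 (volume : Measure ℝ) := fun x hx =>
    hb2.mono' (hfm x).aestronglyMeasurable (hfb1.mono fun ξ h1 => h1 x hx)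
  have hf'2 : ∀ x ∈ Icc 0 L, MemLp (f' x) 2 (volume : Measure ℝ) := fun x hx =>
    hb2.mono' (hf'm x).aestronglyMeasurable (hf'b.mono fun ξ h1 => h1 x hx)
  have hd : ∀ᵐ ξ, ∀ x ∈ Icc 0 L, HasDerivWithinAt (fun y => f y ξ) (f' x ξ) (Icc 0 L) x := by
    filter_upwards [hne] with ξ hξ x _
    exact (((hasDerivAt_dirichletSymbol ξ x).mul_const _).fun_add
      ((hasDerivAt_neumannSymbol ξ x (waveNumber_ne_zero hκ0 hξ)).mul_const _)).hasDerivWithinAt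
  have hd' : ∀ᵐ ξ, ∀ x ∈ Icc 0 L, HasDerivWithinAt (fun y => f' y ξ)
      (waveNumber κ ξ ^ 2 * f x ξ) (Icc 0 L) x := by
    filter_upwards [hne] with ξ hξ x _
    refine ((((hasDerivAt_dirichletSymbolDeriv ξ x).mul_const _).fun_add
      ((hasDerivAt_neumannSymbolDeriv ξ x (waveNumber_ne_zero hκ0 hξ)).mul_const _)).congr_deriv
        ?_).hasDerivWithinAt
    simp only [f]
    ring
  let Φ := (Lp.fourierTransformₗᵢ ℝ ℂ).symm.toContinuousLinearEquiv.toContinuousLinearMap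
  have hΦ : ∀ u : TimeL2, Φ u = 𝓕⁻ u := fun u => rfl
  have hmem : ∀ x, ∀ᶠ y in 𝓝[Icc 0 L] x, y ∈ Icc 0 L := fun x => self_mem_nhdsWithin
  have hres : ∀ q : ℝ → ℂ, MemLp q 2 (volume : Measure ℝ) →
      timeResolvent (𝓕⁻ (toL2 q) : TimeL2) =
        (𝓕⁻ (toL2 fun ξ => resolventSymbol ξ * q ξ) : TimeL2) := by
    intro q hq
    apply (Lp.fourierTransformₗᵢ ℝ ℂ).injective
    change (𝓕 (timeResolvent (𝓕⁻ (toL2 q) : TimeL2)) : TimeL2) =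
      (𝓕 (𝓕⁻ (toL2 fun ξ => resolventSymbol ξ * q ξ) : TimeL2) : TimeL2)
    rw [FourierTransform.fourier_fourierInv_eq]
    have hq' : MemLp (fun ξ => resolventSymbol ξ * q ξ) 2 (volume : Measure ℝ) :=
      hq.of_le (measurable_resolventSymbol.aestronglyMeasurable.mul hq.1)
        (Eventually.of_forall fun ξ => by
          rw [norm_mul]
          exact mul_le_of_le_one_left (norm_nonneg _) (norm_resolventSymbol_le ξ))
    apply Lp.ext
    filter_upwards [coeFn_fourier_timeResolvent (𝓕⁻ (toL2 q) : TimeL2),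
      coeFn_fourier_fourierInv hq, coeFn_toL2 hq'] with ξ h1 h2 h3
    rw [h1, h2, h3]
  refine ⟨fun x => 𝓕⁻ (toL2 (f x)), fun x => 𝓕⁻ (toL2 (f' x)), fun x hx => ?_, fun x hx => ?_,
    ?_, ?_, fun x hx => ?_, fun x hx => ⟨?_, ?_, ?_, ?_⟩⟩
  · exact (Φ.restrictScalars ℝ).hasFDerivAt.comp_hasDerivWithinAt x
      (hasDerivWithinAt_toL2 hf2 hf'2 hb2 hf'b hd x hx)
  · refine (Φ.continuous.tendsto _).comp (tendsto_toL2 (b := fun ξ => 2 * b ξ)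
      ((hmem x).mono hf'2) (hf'2 x hx) (hb2.const_mul 2) ?_ ?_)
    · filter_upwards [hmem x] with y hy
      filter_upwards [hf'b] with ξ h1
      linarith [norm_sub_le (f' y ξ) (f' x ξ), h1 y hy, h1 x hx]
    · filter_upwards [hd'] with ξ h1
      exact (h1 x hx).continuousWithinAt
  · have : toL2 (f 0) = 𝓕 g := by
      rw [← toL2_coeFn (𝓕 g : TimeL2)]
      refine toL2_congr (hf2 0 ⟨le_rfl, hL.le⟩) ?_
      filter_upwards [hne] with ξ hξ
      simp [f, dirichletSymbol, neumannSymbol, (hKb ξ hξ).1, hG]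
    simp only [this]
    exact FourierTransform.fourierInv_fourier_eq g
  · have : toL2 (f' L) = 𝓕 h := by
      rw [← toL2_coeFn (𝓕 h : TimeL2)]
      refine toL2_congr (hf'2 L ⟨hL.le, le_rfl⟩) ?_
      filter_upwards [hne] with ξ hξ
      simp [f', dirichletSymbolDeriv, neumannSymbolDeriv, (hKb ξ hξ).1, hH]
    simp only [this]
    exact FourierTransform.fourierInv_fourier_eq h
  · let p : ℝ → ℝ → ℂ := fun x ξ => resolventSymbol ξ * f' x ξ
    let p' : ℝ → ℝ → ℂ := fun x ξ => κ⁻¹ * (f x ξ - resolventSymbol ξ * f x ξ)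
    have hr : ∀ q : ℝ → ℂ, MemLp q 2 (volume : Measure ℝ) →
        MemLp (fun ξ => resolventSymbol ξ * q ξ) 2 (volume : Measure ℝ) := fun q hq =>
      hq.of_le (measurable_resolventSymbol.aestronglyMeasurable.mul hq.1)
        (Eventually.of_forall fun ξ => by
          rw [norm_mul]
          exact mul_le_of_le_one_left (norm_nonneg _) (norm_resolventSymbol_le ξ))
    have hp2 : ∀ x ∈ Icc 0 L, MemLp (p x) 2 (volume : Measure ℝ) := fun x hx => hr _ (hf'2 x hx)
    have hp'2 : ∀ x ∈ Icc 0 L, MemLp (p' x) 2 (volume : Measure ℝ) := fun x hx =>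
      ((hf2 x hx).sub (hr _ (hf2 x hx))).const_mul _
    have hp'b : ∀ᵐ ξ, ∀ x ∈ Icc 0 L, ‖p' x ξ‖ ≤ ‖κ⁻¹‖ * (2 * b ξ) := by
      filter_upwards [hfb1] with ξ h1 x hx
      have h2 : ‖resolventSymbol ξ * f x ξ‖ ≤ ‖f x ξ‖ := by
        rw [norm_mul]
        exact mul_le_of_le_one_left (norm_nonneg _) (norm_resolventSymbol_le ξ)
      simp only [p']
      rw [norm_mul]
      gcongr
      linarith [norm_sub_le (f x ξ) (resolventSymbol ξ * f x ξ), h1 x hx]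
    -- With r = 1/(1 + iτ) one has rλ² = κ⁻¹(1 - r), which is bounded. The resolvent thus absorbs
    -- λ², whose product with `f x` need not be square-integrable.
    have hpd : ∀ᵐ ξ, ∀ x ∈ Icc 0 L, HasDerivWithinAt (fun y => p y ξ) (p' x ξ) (Icc 0 L) x := by
      filter_upwards [hd'] with ξ h1 x hx
      refine ((h1 x hx).const_mul (resolventSymbol ξ)).congr_deriv ?_
      have h2 := resolvent_denom_ne_zero ξ
      simp only [p']
      rw [waveNumber_sq, resolventSymbol]
      field_simp
      ring
    have h1 := hasDerivWithinAt_toL2 hp2 hp'2 ((hb2.const_mul 2).const_mul ‖κ⁻¹‖) hp'b hpd x hx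
    have h2 := (Φ.restrictScalars ℝ).hasFDerivAt.comp_hasDerivWithinAt x h1
    have h3 : Φ (toL2 (p' x)) = κ⁻¹ • ((𝓕⁻ (toL2 (f x)) : TimeL2) -
        timeResolvent (𝓕⁻ (toL2 (f x)) : TimeL2)) := by
      rw [hres _ (hf2 x hx), ← fourierInv_sub, ← toL2_sub (hf2 x hx) (hr _ (hf2 x hx)), ← hΦ,
        ← map_smul, ← toL2_const_mul _ (f := fun ξ => f x ξ - resolventSymbol ξ * f x ξ)
          ((hf2 x hx).sub (hr _ (hf2 x hx)))]
    rw [← h3]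
    exact h2.congr (fun y hy => hres _ (hf'2 y hy)) (hres _ (hf'2 x hx))
  · refine (sobolevNorm_fourierInv_le (hf2 x hx) (hfb.mono fun ξ h1 => h1 x hx) _).trans
      (ENNReal_sqrt_le_of_le_sq ?_)
    rw [lintegral_symbolBound_div]
    exact hle
  · exact (sobolevNorm_fourierInv_le (hf'2 x hx) (hf'b.mono fun ξ h1 => h1 x hx) _).trans
      (ENNReal_sqrt_le_of_le_sq hle)
  · refine tendsto_sobolevNorm_fourierInv_sub hf2 hfb ?_ ?_ hx
    · filter_upwards [hd] with ξ h1 y hy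
      exact (h1 y hy).continuousWithinAt
    · rw [lintegral_symbolBound_div]
      exact hfin
  · refine tendsto_sobolevNorm_fourierInv_sub hf'2 hf'b ?_ hfin hx
    filter_upwards [hd'] with ξ h1 y hy
    exact (h1 y hy).continuousWithinAt

end

/-! ### From the resolvent equation back to the weak equation -/

section

open scoped SchwartzMap ContDiff ComplexConjugate

/-- The directional derivative of a function on the plane. -/
def dirDeriv (w : ℝ × ℝ) (a : ℝ × ℝ → ℂ) (p : ℝ × ℝ) : ℂ := fderiv ℝ a p w

lemma ContDiff.dirDeriv {a : ℝ × ℝ → ℂ} (ha : ContDiff ℝ ∞ a) (w : ℝ × ℝ) :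
    ContDiff ℝ ∞ (dirDeriv w a) :=
  (ha.fderiv_right (m := ∞) (by simp)).clm_apply contDiff_const

lemma HasCompactSupport.dirDeriv {a : ℝ × ℝ → ℂ} (ha : HasCompactSupport a) (w : ℝ × ℝ) :
    HasCompactSupport (dirDeriv w a) := ha.fderiv_apply ℝ w

lemma tsupport_dirDeriv_subset (a : ℝ × ℝ → ℂ) (w : ℝ × ℝ) :
    tsupport (dirDeriv w a) ⊆ tsupport a := tsupport_fderiv_apply_subset ℝ w

lemma dirDeriv_comm {a : ℝ × ℝ → ℂ} (ha : ContDiff ℝ ∞ a) (w z p : ℝ × ℝ) :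
    dirDeriv w (dirDeriv z a) p = dirDeriv z (dirDeriv w a) p := by
  have hs : IsSymmSndFDerivAt ℝ a p := ha.contDiffAt.isSymmSndFDerivAt (by
    simp only [minSmoothness_of_isRCLikeNormedField]
    exact WithTop.coe_le_coe.2 (le_top (a := (2 : ℕ∞))))
  have hd : DifferentiableAt ℝ (fderiv ℝ a) p :=
    ((ha.fderiv_right (m := ∞) (by simp)).differentiable (by simp)) p
  have h : ∀ w z : ℝ × ℝ, dirDeriv w (dirDeriv z a) p = fderiv ℝ (fderiv ℝ a) p w z := by
    intro w z
    have := fderiv_clm_apply (c := fderiv ℝ a) (u := fun _ => z) hd (differentiableAt_const z)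
    simp only [dirDeriv]
    change fderiv ℝ (fun y => fderiv ℝ a y z) p w = _
    rw [this]
    simp
  rw [h, h]
  exact hs w z

lemma hasDerivAt_fst {a : ℝ × ℝ → ℂ} (ha : ContDiff ℝ ∞ a) (x t : ℝ) :
    HasDerivAt (fun y => a (y, t)) (dirDeriv (1, 0) a (x, t)) x :=
  ((ha.differentiable (by simp)) (x, t)).hasFDerivAt.comp_hasDerivAt x
    ((hasDerivAt_id x).prodMk (hasDerivAt_const x t))

lemma hasDerivAt_snd {a : ℝ × ℝ → ℂ} (ha : ContDiff ℝ ∞ a) (x t : ℝ) :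
    HasDerivAt (fun y => a (x, y)) (dirDeriv (0, 1) a (x, t)) t :=
  ((ha.differentiable (by simp)) (x, t)).hasFDerivAt.comp_hasDerivAt t
    ((hasDerivAt_const t x).prodMk (hasDerivAt_id t))

/-- The conjugate of a time slice of a function on the plane, as an element of `L²(ℝ)`. -/
def conjSlice (a : ℝ × ℝ → ℂ) (x : ℝ) : TimeL2 := toL2 fun t => conj (a (x, t))

lemma hasCompactSupport_slice {a : ℝ × ℝ → ℂ} (hc : HasCompactSupport a) (x : ℝ) :
    HasCompactSupport fun t => conj (a (x, t)) := by
  refine HasCompactSupport.of_support_subset_isCompact (IsCompact.image hc continuous_snd)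
    fun t ht => ⟨(x, t), subset_tsupport _ fun h => ht ?_, rfl⟩
  simp [h]

lemma contDiff_slice {a : ℝ × ℝ → ℂ} (ha : ContDiff ℝ ∞ a) (x : ℝ) :
    ContDiff ℝ ∞ fun t => conj (a (x, t)) :=
  Complex.conjCLE.contDiff.comp (ha.comp (contDiff_const.prodMk contDiff_id))

lemma memLp_slice {a : ℝ × ℝ → ℂ} (ha : ContDiff ℝ ∞ a) (hc : HasCompactSupport a) (x : ℝ) :
    MemLp (fun t => conj (a (x, t))) 2 (volume : Measure ℝ) :=
  memLp_of_continuous (contDiff_slice ha x).continuous (hasCompactSupport_slice hc x)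

lemma hasDerivWithinAt_conjSlice {a : ℝ × ℝ → ℂ} (ha : ContDiff ℝ ∞ a) (hc : HasCompactSupport a)
    {L : ℝ} : ∀ x ∈ Icc 0 L,
      HasDerivWithinAt (conjSlice a) (conjSlice (dirDeriv (1, 0) a) x) (Icc 0 L) x := by
  have ha' := ha.dirDeriv (1, 0)
  have hc' := hc.dirDeriv (1, 0)
  obtain ⟨C, hC⟩ := hc'.exists_bound_of_continuous ha'.continuous
  -- The time projection of the support is compact, so its indicator times C is a square-integrable
  -- bound uniform in x.
  set K := Prod.snd '' tsupport (dirDeriv (1, 0) a) with hKdef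
  have hK : IsCompact K := IsCompact.image hc' continuous_snd
  refine hasDerivWithinAt_toL2 (b := K.indicator fun _ => C) (fun x _ => memLp_slice ha hc x)
    (fun x _ => memLp_slice ha' hc' x)
    (memLp_indicator_const 2 hK.measurableSet C (Or.inr hK.measure_lt_top.ne))
    (Eventually.of_forall fun t x _ => ?_) (Eventually.of_forall fun t x _ => ?_)
  · rw [RCLike.norm_conj]
    by_cases ht : t ∈ K
    · rw [indicator_of_mem ht]
      exact hC _
    · rw [indicator_of_notMem ht, image_eq_zero_of_notMem_tsupport fun h => ht ⟨_, h, rfl⟩,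
        norm_zero]
  · exact ((Complex.conjCLE : ℂ →L[ℝ] ℂ).hasFDerivAt.comp_hasDerivAt x
      (hasDerivAt_fst ha x t)).hasDerivWithinAt

/-- The conjugate in the slice cancels the one in the inner product, leaving the bilinear pairing of
the weak form. -/
lemma inner_conjSlice {a : ℝ × ℝ → ℂ} (ha : ContDiff ℝ ∞ a) (hc : HasCompactSupport a) (x : ℝ)
    (u : TimeL2) : inner ℂ (conjSlice a x) u = ∫ t, a (x, t) * u t := by
  rw [conjSlice, inner_toL2 (memLp_slice ha hc x)]
  simp

/-- The adjoint relation for the resolvent, on slices of test functions. -/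
lemma inner_conjSlice_timeResolvent {a : ℝ × ℝ → ℂ} (ha : ContDiff ℝ ∞ a)
    (hc : HasCompactSupport a) (x : ℝ) (u : TimeL2) :
    inner ℂ (conjSlice a x - conjSlice (dirDeriv (0, 1) a) x) (timeResolvent u) =
      inner ℂ (conjSlice a x) u := by
  have h := inner_sub_deriv_timeResolvent
    ((hasCompactSupport_slice hc x).toSchwartzMap (contDiff_slice ha x)) u
  have h1 : deriv (fun t => conj (a (x, t))) = fun t => conj (dirDeriv (0, 1) a (x, t)) := by
    ext t
    exact ((Complex.conjCLE : ℂ →L[ℝ] ℂ).hasFDerivAt.comp_hasDerivAt t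
      (hasDerivAt_snd ha x t)).deriv
  have h2 : ⇑((hasCompactSupport_slice hc x).toSchwartzMap (contDiff_slice ha x)) =
    fun t => conj (a (x, t)) := rfl
  rw [h2, h1] at h
  exact h

lemma conjSlice_eq_zero {a : ℝ × ℝ → ℂ} {L T x : ℝ} (hs : tsupport a ⊆ Ioo 0 L ×ˢ Iio T)
    (hx : x ∉ Ioo 0 L) : conjSlice a x = 0 := by
  have h : (fun t => conj (a (x, t))) = fun _ => 0 := by
    ext t
    rw [image_eq_zero_of_notMem_tsupport fun h => hx (hs h).1, map_zero]
  rw [conjSlice, h]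
  apply Lp.ext
  filter_upwards [coeFn_toL2 (f := fun _ => 0) MemLp.zero,
    Lp.coeFn_zero ℂ 2 (volume : Measure ℝ)] with t h1 h2
  rw [h1, h2, Pi.zero_apply]

/-- The resolvent form of the equation implies the weak form. -/
lemma integral_weak_eq_zero {κ : ℂ} (hκ : κ ≠ 0) {L T : ℝ} (hL : 0 < L) {V V' : ℝ → TimeL2}
    (hV : ∀ x ∈ Icc 0 L, HasDerivWithinAt V (V' x) (Icc 0 L) x)
    (hW : ∀ x ∈ Icc 0 L, HasDerivWithinAt (fun y => timeResolvent (V' y))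
      (κ⁻¹ • (V x - timeResolvent (V x))) (Icc 0 L) x)
    {φ : ℝ × ℝ → ℂ} (hφ : ContDiff ℝ ∞ φ) (hc : HasCompactSupport φ)
    (hs : tsupport φ ⊆ Ioo 0 L ×ˢ Iio T) :
    ∫ x in Ioo 0 L, (inner ℂ (conjSlice (dirDeriv (0, 1) φ) x) (V x) +
      κ * inner ℂ (conjSlice (dirDeriv (1, 0) (dirDeriv (1, 0) φ)) x) (V x)) = 0 := by
  have hφx := hφ.dirDeriv (1, 0)
  have hφt := hφ.dirDeriv (0, 1)
  have hφxx := hφx.dirDeriv (1, 0)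
  have hcx := hc.dirDeriv (1, 0)
  have hct := hc.dirDeriv (0, 1)
  have hcxx := hcx.dirDeriv (1, 0)
  -- By the adjoint relation this is the Green flux κ(⟨φ, V'⟩ - ⟨φ_x, V⟩), written through RV'
  -- because only RV' is known to be differentiable in x. In its derivative the terms with φ_x and
  -- V' cancel.
  let Q : ℝ → ℂ := fun x => κ * (inner ℂ (conjSlice φ x - conjSlice (dirDeriv (0, 1) φ) x)
    (timeResolvent (V' x)) - inner ℂ (conjSlice (dirDeriv (1, 0) φ) x) (V x))
  let I : ℝ → ℂ := fun x => inner ℂ (conjSlice (dirDeriv (0, 1) φ) x) (V x) +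
      κ * inner ℂ (conjSlice (dirDeriv (1, 0) (dirDeriv (1, 0) φ)) x) (V x)
  have hVc : ContinuousOn V (Icc 0 L) := fun x hx => (hV x hx).continuousWithinAt
  have hIc : ContinuousOn I (Icc 0 L) :=
    (ContinuousOn.inner (𝕜 := ℂ) (fun x hx =>
      (hasDerivWithinAt_conjSlice hφt hct x hx).continuousWithinAt) hVc).add
    (continuousOn_const.mul (ContinuousOn.inner (𝕜 := ℂ) (fun x hx =>
      (hasDerivWithinAt_conjSlice hφxx hcxx x hx).continuousWithinAt) hVc))
  have hQ : ∀ x ∈ Icc 0 L, HasDerivWithinAt Q (-I x) (Icc 0 L) x := by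
    intro x hx
    have h1 := ((hasDerivWithinAt_conjSlice hφ hc x hx).sub
      (hasDerivWithinAt_conjSlice hφt hct x hx)).inner ℂ (hW x hx)
    have h2 := (hasDerivWithinAt_conjSlice hφx hcx x hx).inner ℂ (hV x hx)
    refine ((h1.sub h2).const_mul κ).congr_deriv ?_
    have e1 : conjSlice (dirDeriv (1, 0) (dirDeriv (0, 1) φ)) x =
        conjSlice (dirDeriv (0, 1) (dirDeriv (1, 0) φ)) x := by
      rw [conjSlice, conjSlice]
      congr 1
      ext t
      rw [dirDeriv_comm hφ]
    have e2 := inner_conjSlice_timeResolvent hφ hc x (V x)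
    simp only [Pi.sub_apply]
    rw [e1, inner_conjSlice_timeResolvent hφx hcx, inner_smul_right, inner_sub_right, e2,
      inner_sub_left]
    simp only [I]
    field_simp
    ring
  have hz : ∀ x ∉ Ioo 0 L, Q x = 0 := fun x hx => by
    simp only [Q]
    rw [conjSlice_eq_zero hs hx, conjSlice_eq_zero ((tsupport_dirDeriv_subset _ _).trans hs) hx,
      conjSlice_eq_zero ((tsupport_dirDeriv_subset _ _).trans hs) hx]
    simp
  have hInt := intervalIntegral.integral_eq_sub_of_hasDerivAt_of_le (f := Q) (f' := fun x => -I x)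
    hL.le (fun x hx => (hQ x hx).continuousWithinAt)
    (fun x hx => (hQ x (Ioo_subset_Icc_self hx)).hasDerivAt (Icc_mem_nhds hx.1 hx.2))
    (hIc.neg.intervalIntegrable_of_Icc hL.le)
  rw [hz 0 (by simp), hz L (by simp), sub_zero, intervalIntegral.integral_neg, neg_eq_zero,
    intervalIntegral.integral_of_le hL.le, integral_Ioc_eq_integral_Ioo] at hInt
  exact hInt

/-- A causal solution on the whole time line restricts to a reduced solution. -/
lemma isReducedSolution_restrictTime {ν α L T : ℝ} (hν : 0 < ν) (hL : 0 < L) {g h : TimeL2}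
    {V V' : ℝ → TimeL2}
    (hV : ∀ x ∈ Icc 0 L, HasDerivWithinAt V (V' x) (Icc 0 L) x)
    (hV'c : ContinuousOn V' (Icc 0 L)) (h0 : V 0 = g) (h1 : V' L = h)
    (hW : ∀ x ∈ Icc 0 L, HasDerivWithinAt (fun y => timeResolvent (V' y))
      (((ν : ℂ) + Complex.I * α)⁻¹ • (V x - timeResolvent (V x))) (Icc 0 L) x)
    (hpast : ∀ x ∈ Icc 0 L, past 0 (V x) = 0) :
    IsReducedSolution ν α L T g h (fun x => restrictTime T (V x))
      (fun x => restrictTime T (V' x)) where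
  hasDeriv x hx := ((restrictTime T).restrictScalars ℝ).hasFDerivAt.comp_hasDerivWithinAt x (hV x hx)
  continuousOn_deriv := (restrictTime T).continuous.comp_continuousOn hV'c
  dirichlet := h0 ▸ coeFn_restrictTime T (V 0)
  neumann := h1 ▸ coeFn_restrictTime T (V' L)
  equation φ hφ hc hs := by
    have hκ : (ν : ℂ) + Complex.I * α ≠ 0 := fun h => by
      have := congrArg Complex.re h
      simp at this
      exact hν.ne' this
    rw [← integral_weak_eq_zero hκ hL hV hW hφ hc hs]
    refine setIntegral_congr_fun measurableSet_Ioo fun x hx => ?_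
    have hx' := Ioo_subset_Icc_self hx
    have hφx := hφ.dirDeriv (1, 0)
    have hφt := hφ.dirDeriv (0, 1)
    have hφxx := hφx.dirDeriv (1, 0)
    have hct := hc.dirDeriv (0, 1)
    have hcxx := (hc.dirDeriv (1, 0)).dirDeriv (1, 0)
    have hint : ∀ a : ℝ × ℝ → ℂ, ContDiff ℝ ∞ a → HasCompactSupport a →
        Integrable (fun t => a (x, t) * V x t) := fun a ha hca => by
      have := MemLp.integrable_mul ((memLp_slice ha hca x).star) (Lp.memLp (V x))
      refine this.congr (Eventually.of_forall fun t => ?_)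
      simp
    rw [inner_conjSlice hφt hct, inner_conjSlice hφxx hcxx, ← integral_const_mul,
      ← integral_add (hint _ hφt hct) ((hint _ hφxx hcxx).const_mul _),
      ← integral_indicator measurableSet_Ioo]
    have hd1 : ∀ t, deriv (fun t' => φ (x, t')) t = dirDeriv (0, 1) φ (x, t) := fun t =>
      (hasDerivAt_snd hφ x t).deriv
    have hd2 : ∀ t, iteratedDeriv 2 (fun x' => φ (x', t)) x =
        dirDeriv (1, 0) (dirDeriv (1, 0) φ) (x, t) := fun t => by
      rw [iteratedDeriv_succ, iteratedDeriv_one]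
      have : deriv (fun x' => φ (x', t)) = fun x' => dirDeriv (1, 0) φ (x', t) := by
        ext y
        exact (hasDerivAt_fst hφ y t).deriv
      rw [this]
      exact (hasDerivAt_fst hφx x t).deriv
    have hne : ∀ᵐ t : ℝ, t ≠ 0 := by simp [ae_iff]
    refine integral_congr_ae ?_
    filter_upwards [(ae_restrict_iff' measurableSet_Ioo).1 (coeFn_restrictTime T (V x)),
      (past_eq_zero_iff 0 (V x)).1 (hpast x hx'), hne] with t e1 e2 e3
    by_cases ht : t ∈ Ioo 0 T
    · rw [indicator_of_mem ht, e1 ht, hd1, hd2]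
      ring
    -- Outside (0, T) the integrand vanishes: before 0 because V is causal, which encodes the
    -- initial condition, and from T on because φ is zero there.
    · rw [indicator_of_notMem ht]
      rcases lt_or_gt_of_ne e3 with h | h
      · simp [e2 h]
      · have hz : ∀ a : ℝ × ℝ → ℂ, tsupport a ⊆ tsupport φ → a (x, t) = 0 := fun a ha =>
          image_eq_zero_of_notMem_tsupport fun h' => ht ⟨h, (hs (ha h')).2⟩
        rw [hz _ (tsupport_dirDeriv_subset _ _),
          hz _ ((tsupport_dirDeriv_subset _ _).trans (tsupport_dirDeriv_subset _ _))]
        simp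

end

end

/-! ### Conclusion -/

lemma sobolevNormOn_restrictTime_le (m T : ℝ) (U : TimeL2) :
    sobolevNormOn m T (restrictTime T U) ≤ sobolevNorm m U := by
  refine iInf₂_le U ?_
  filter_upwards [coeFn_restrictTime T U] with t ht
  exact ht.symm

/-- For data vanishing at negative times, the solution on the whole time line is causal. -/
lemma past_eq_zero_of_wholeLine {κ : ℂ} (hκ : 0 < κ.re) {L : ℝ} (hL : 0 < L) {V V' : ℝ → TimeL2}
    (hV : ∀ x ∈ Icc 0 L, HasDerivWithinAt V (V' x) (Icc 0 L) x)
    (hW : ∀ x ∈ Icc 0 L, HasDerivWithinAt (fun y => timeResolvent (V' y))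
      (κ⁻¹ • (V x - timeResolvent (V x))) (Icc 0 L) x)
    (h0 : past 0 (V 0) = 0) (h1 : past 0 (V' L) = 0) : ∀ x ∈ Icc 0 L, past 0 (V x) = 0 := by
  refine past_eq_zero_of_resolvent_equation (norm_past_le 0) norm_cayley_le (past_past 0)
    (past_timeResolvent 0) hκ hL hV (fun x hx => ?_) h0 h1
  have := ((past 0).restrictScalars ℝ).hasFDerivAt.comp_hasDerivWithinAt x (hW x hx)
  refine this.congr_deriv ?_
  exact map_smul (past 0) _ _

theorem theorem2p2 (ν α L s : ℝ) (hν : 0 < ν) (hL : 0 < L) (hs : 1 / 2 ≤ s) :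
    ∃ c : ℝ → ℝ, (∀ T : ℝ, 0 < T → 0 < c T) ∧
      (∃ δ M : ℝ, 0 < δ ∧ ∀ T ∈ Ioo 0 δ, c T ≤ M) ∧
      ∀ T : ℝ, 0 < T → ∀ g h : TimeL2,
        sobolevNorm ((2 * s + 1) / 4) g < ∞ →
        sobolevNorm ((2 * s - 1) / 4) h < ∞ →
        (∀ᵐ t : ℝ, t ∉ Ioo 0 T → g t = 0) →
        (∀ᵐ t : ℝ, t ∉ Ioo 0 T → h t = 0) →
        (∃ v vx : ℝ → TimeL2On T, IsReducedSolution ν α L T g h v vx) ∧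
        (∀ v vx v' vx' : ℝ → TimeL2On T, IsReducedSolution ν α L T g h v vx →
          IsReducedSolution ν α L T g h v' vx' → EqOn v v' (Icc 0 L)) ∧
        ∀ v vx : ℝ → TimeL2On T, IsReducedSolution ν α L T g h v vx →
          (⨆ x ∈ Icc 0 L, sobolevNormOn ((2 * s + 1) / 4) T (v x)) ≤
            ENNReal.ofReal (c T) *
              (sobolevNorm ((2 * s + 1) / 4) g + sobolevNorm ((2 * s - 1) / 4) h) ∧
          (⨆ x ∈ Icc 0 L, sobolevNormOn ((2 * s - 1) / 4) T (vx x)) ≤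
            ENNReal.ofReal (c T) *
              (sobolevNorm ((2 * s + 1) / 4) g + sobolevNorm ((2 * s - 1) / 4) h) ∧
          ContinuousIntoSobolev ((2 * s + 1) / 4) L T v ∧
          ContinuousIntoSobolev ((2 * s - 1) / 4) L T vx := by
  have hκ : 0 < ((ν : ℂ) + Complex.I * α).re := by simpa using hν
  obtain ⟨K, hK, hsol⟩ := exists_wholeLine_solution hκ hL
  -- The whole-line bound does not involve T, so a constant function of T serves.
  refine ⟨fun _ => K, fun _ _ => hK, ⟨1, K, one_pos, fun _ _ => le_rfl⟩,
    fun T hT g h hg hh hg0 hh0 => ?_⟩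
  obtain ⟨V, V', hV, hV'c, h0, h1, hW, hest⟩ := hsol s hs g h hg hh
  have hpast : ∀ u : TimeL2, (∀ᵐ t : ℝ, t ∉ Ioo 0 T → u t = 0) → past 0 u = 0 := fun u hu =>
    (past_eq_zero_iff 0 u).2 (hu.mono fun t ht ht' => ht fun h => absurd h.1 ht'.le.not_gt)
  have hP := past_eq_zero_of_wholeLine hκ hL hV hW (h0 ▸ hpast g hg0) (h1 ▸ hpast h hh0)
  have hred := isReducedSolution_restrictTime (T := T) hν hL hV hV'c h0 h1 hW hP
  refine ⟨⟨_, _, hred⟩, fun v vx v' vx' e1 e2 => e1.unique hν hL hT e2, fun v vx hv => ?_⟩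
  -- Uniqueness identifies an arbitrary solution with the restricted one, and derivatives within [0,
  -- L] are unique. All estimates then pass through the whole-line extension.
  have ev : ∀ x ∈ Icc 0 L, v x = restrictTime T (V x) := hv.unique hν hL hT hred
  have evx : ∀ x ∈ Icc 0 L, vx x = restrictTime T (V' x) := fun x hx =>
    (uniqueDiffOn_Icc hL x hx).eq_deriv _ (hv.hasDeriv x hx)
      ((hred.hasDeriv x hx).congr ev (ev x hx))
  have hfin : ENNReal.ofReal K *
      (sobolevNorm ((2 * s + 1) / 4) g + sobolevNorm ((2 * s - 1) / 4) h) < ∞ :=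
    ENNReal.mul_lt_top ENNReal.ofReal_lt_top (ENNReal.add_lt_top.2 ⟨hg, hh⟩)
  have b1 : ∀ x ∈ Icc 0 L, sobolevNormOn ((2 * s + 1) / 4) T (v x) ≤ ENNReal.ofReal K *
      (sobolevNorm ((2 * s + 1) / 4) g + sobolevNorm ((2 * s - 1) / 4) h) := fun x hx => by
    rw [ev x hx]
    exact (sobolevNormOn_restrictTime_le _ T _).trans (hest x hx).1
  have b2 : ∀ x ∈ Icc 0 L, sobolevNormOn ((2 * s - 1) / 4) T (vx x) ≤ ENNReal.ofReal K *
      (sobolevNorm ((2 * s + 1) / 4) g + sobolevNorm ((2 * s - 1) / 4) h) := fun x hx => by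
    rw [evx x hx]
    exact (sobolevNormOn_restrictTime_le _ T _).trans (hest x hx).2.1
  refine ⟨iSup₂_le b1, iSup₂_le b2, fun x hx => ⟨(b1 x hx).trans_lt hfin, ?_⟩,
    fun x hx => ⟨(b2 x hx).trans_lt hfin, ?_⟩⟩
  · refine tendsto_of_tendsto_of_tendsto_of_le_of_le' tendsto_const_nhds (hest x hx).2.2.1
      (Eventually.of_forall fun _ => zero_le) ?_
    filter_upwards [self_mem_nhdsWithin] with y hy
    rw [ev x hx, ev y hy, ← map_sub]
    exact sobolevNormOn_restrictTime_le _ T _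
  · refine tendsto_of_tendsto_of_tendsto_of_le_of_le' tendsto_const_nhds (hest x hx).2.2.2
      (Eventually.of_forall fun _ => zero_le) ?_
    filter_upwards [self_mem_nhdsWithin] with y hy
    rw [evx x hx, evx y hy, ← map_sub]
    exact sobolevNormOn_restrictTime_le _ T _
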